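/- Let $\mathbf{W^*}$ be the category of $W^*$-algebras, presented as von Neumann algebras $\mathcal M\subseteq\mathcal B(\mathcal H)$, with unital normal (i.e. $w^*$-continuous) $*$-homomorphisms as morphisms. Let $\overline{\otimes}$ be the spatial tensor product, $\bigoplus_\alpha\mathcal N_\alpha$ the direct sum (all bounded families) with projections $p_\alpha:\bigoplus_\beta\mathcal N_\beta\to\mathcal N_\alpha$, and let the free product $\mathop{\ast}_\alpha\mathcal M_\alpha$ with inclusions $\iota_\alpha$ be the coproduct in $\mathbf{W^*}$. A free exponential of $\mathcal M$ and $\mathcal N$ is a $W^*$-algebra $\mathcal M^{\ast\mathcal N}$ with a morphism $\varepsilon:\mathcal M\to\mathcal M^{\ast\mathcal N}\overline{\otimes}\mathcal N$ such that for every $W^*$-algebra $\mathcal R$ and every morphism $\pi:\mathcal M\to\mathcal R\overline{\otimes}\mathcal N$ there is a unique morphism $\rho:\mathcal M^{\ast\mathcal N}\to\mathcal R$ with $\pi=(\rho\,\overline{\otimes}\,1)\circ\varepsilon$; it is determined up to a canonical isomorphism. A morphism $f:\mathcal M\to\mathcal M'$ and a morphism $g:\mathcal N'\to\mathcal N$ induce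 the unique morphism $f^{\ast g}:\mathcal M^{\ast\mathcal N}\to\mathcal M'^{\ast\mathcal N'}$ with $(f^{\ast g}\,\overline{\otimes}\,1)\circ\varepsilon=(1\,\overline{\otimes}\,g)\circ\varepsilon'\circ f$. Let $\mathcal M$ be a $W^*$-algebra and $\{\mathcal N_\alpha\}$ an indexed family of $W^*$-algebras (all free exponentials and free products below being given, up to isomorphism, by their universal properties). 1. There is a unique morphism $\delta:\mathcal M\to(\mathop{\ast}_\alpha\mathcal M^{\ast\mathcal N_\alpha})\overline{\otimes}\bigoplus_\alpha\mathcal N_\alpha$ with $(1\,\overline{\otimes}\,p_\alpha)\circ\delta=(\iota_\alpha\overline{\otimes}\,1)\circ\varepsilon_\alpha$ for all $\alpha$, and with it $\mathop{\ast}_\alpha\mathcal M^{\ast\mathcal N_\alpha}$ is a free exponential of $\mathcal M$ and $\bigoplus_\alpha\mathcal N_\alpha$. Consequently $$\mathcal M^{\ast(\bigoplus_\alpha\mathcal N_\alpha)}\;\cong\;\mathop{\ast}_\alpha\mathcal M^{\ast\mathcal N_\alpha}$$ by a unique isomorphism $\theta$ such that $((\theta^{-1}\circ\iota_\alpha)\,\overline{\otimes}\,1)\circ\varepsilon_\alpha=(1\,\overline{\otimes}\,p_\alpha)\circ\varepsilon$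 for all $\alpha$, where $\varepsilon$ belongs to $\mathcal M^{\ast(\bigoplus_\alpha\mathcal N_\alpha)}$. 2. These isomorphisms are natural in $\mathcal M$ and in the family $\{\mathcal N_\alpha\}$: for all morphisms $f:\mathcal M\to\mathcal M'$ and $g_\alpha:\mathcal N'_\alpha\to\mathcal N_\alpha$, the induced morphisms exist and are unique, and $\theta'\circ f^{\ast(\bigoplus_\alpha g_\alpha)}=(\mathop{\ast}_\alpha f^{\ast g_\alpha})\circ\theta$. 3. For every set $X$, there is a unique morphism $\delta:\mathcal M\to(\mathop{\ast}_{x\in X}\mathcal M)\overline{\otimes}\ell^\infty(X)$ whose evaluation at each $x\in X$ is $\iota_x$, and with it $\mathop{\ast}_{x\in X}\mathcal M$ is a free exponential of $\mathcal M$ and $\ell^\infty(X)$. Consequently $\mathcal M^{\ast\ell^\infty(X)}\cong\mathop{\ast}_{x\in X}\mathcal M$, by a unique isomorphism $\theta$ such that for every $x$ the morphism $\theta^{-1}\circ\iota_x$ is $\varepsilon:\mathcal M\to\mathcal M^{\ast\ell^\infty(X)}\overline{\otimes}\ell^\infty(X)$ followed by evaluation at $x$. -/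

import Mathlib

open CategoryTheory CategoryTheory.Limits
open scoped TensorProduct

universe u v

noncomputable section

namespace FreeExp

section Generated

variable {H : Type u} [NormedAddCommGroup H] [InnerProductSpace ℂ H] [CompleteSpace H]

/-- The von Neumann algebra generated by a set `s` of bounded operators: the double commutant of
`s ∪ s*`. -/
def vnGenerated (s : Set (H →L[ℂ] H)) : VonNeumannAlgebra H where
  toStarSubalgebra := StarSubalgebra.centralizer ℂ (StarSubalgebra.centralizer ℂ s : Set (H →L[ℂ] H))
  centralizer_centralizer' := by
    change Set.centralizer (Set.centralizer
      ((StarSubalgebra.centralizer ℂ (StarSubalgebra.centralizer ℂ s : Set (H →L[ℂ] H)) :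
        StarSubalgebra ℂ (H →L[ℂ] H)) : Set (H →L[ℂ] H))) =
      ((StarSubalgebra.centralizer ℂ (StarSubalgebra.centralizer ℂ s : Set (H →L[ℂ] H)) :
        StarSubalgebra ℂ (H →L[ℂ] H)) : Set (H →L[ℂ] H))
    rw [StarSubalgebra.coe_centralizer_centralizer, Set.centralizer_centralizer_centralizer]

theorem subset_vnGenerated (s : Set (H →L[ℂ] H)) {T : H →L[ℂ] H} (hT : T ∈ s) :
    T ∈ (vnGenerated s).toStarSubalgebra := by
  change T ∈ ((StarSubalgebra.centralizer ℂ (StarSubalgebra.centralizer ℂ s : Set (H →L[ℂ] H)) :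
        StarSubalgebra ℂ (H →L[ℂ] H)) : Set (H →L[ℂ] H))
  rw [StarSubalgebra.coe_centralizer_centralizer]
  exact Set.subset_centralizer_centralizer (Or.inl hT)

end Generated

section HilbertTensor

variable {H : Type u} [NormedAddCommGroup H] [InnerProductSpace ℂ H]
  {K : Type v} [NormedAddCommGroup K] [InnerProductSpace ℂ K]

/-- The Hilbert space tensor product of `H` and `K`. -/
abbrev HilbertTensor (H : Type u) [NormedAddCommGroup H] [InnerProductSpace ℂ H]
    (K : Type v) [NormedAddCommGroup K] [InnerProductSpace ℂ K] : Type (max u v) :=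
  UniformSpace.Completion (H ⊗[ℂ] K)

/-- The bounded operator `a ⊗ b` on the Hilbert space tensor product. -/
def tensorOp (a : H →L[ℂ] H) (b : K →L[ℂ] K) : HilbertTensor H K →L[ℂ] HilbertTensor H K :=
  (TensorProduct.mapL a b).completion

theorem tensorOp_tmul (a : H →L[ℂ] H) (b : K →L[ℂ] K) (x : H) (y : K) :
    tensorOp a b ((x ⊗ₜ[ℂ] y : H ⊗[ℂ] K) : HilbertTensor H K) =
      ((a x ⊗ₜ[ℂ] b y : H ⊗[ℂ] K) : HilbertTensor H K) := by
  simp [tensorOp]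

end HilbertTensor

/-- A `W*`-algebra, presented as a von Neumann algebra of operators on some Hilbert space. The space
only serves to define the `w*`-topology and the spatial tensor product; morphisms ignore it. -/
structure WStar : Type (u + 1) where
  space : Type u
  [normed : NormedAddCommGroup space]
  [innerProd : InnerProductSpace ℂ space]
  [complete : CompleteSpace space]
  alg : VonNeumannAlgebra space

attribute [instance] WStar.normed WStar.innerProd WStar.complete

namespace WStar

/-- The algebra of operators underlying a `W*`-algebra. -/
abbrev Carrier (M : WStar.{u}) : Type u := M.alg.toStarSubalgebra

/-- The `w*`-topology (ultraweak topology) of a von Neumann algebra on `H`: the coarsest topology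
for which the functionals `a ↦ ∑ₙ ⟪ξₙ, a ηₙ⟫`, for square-summable sequences `ξ`, `η` in `H`, are
continuous. These functionals are precisely the elements of the predual. -/
abbrev weakStar (M : WStar.{u}) : TopologicalSpace M.Carrier :=
  TopologicalSpace.induced
    (fun (a : M.Carrier)
      (p : lp (fun _ : ℕ => M.space) 2 × lp (fun _ : ℕ => M.space) 2) =>
        ∑' n, inner ℂ (p.1 n) ((a : M.space →L[ℂ] M.space) (p.2 n)))
    Pi.topologicalSpace

/-- Morphisms of `W*`-algebras: unital normal (that is, `w*`-continuous) `*`-homomorphisms. -/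
@[ext]
structure Hom (M N : WStar.{u}) : Type u where
  toFun : M.Carrier →⋆ₐ[ℂ] N.Carrier
  normal : @Continuous _ _ M.weakStar N.weakStar toFun

instance : Category WStar.{u} where
  Hom := Hom
  id M := ⟨StarAlgHom.id ℂ M.Carrier, @continuous_id _ M.weakStar⟩
  comp {M N R} f g := ⟨g.toFun.comp f.toFun,
    @Continuous.comp _ _ _ M.weakStar N.weakStar R.weakStar _ _ g.normal f.normal⟩

/-- The spatial tensor product: the von Neumann algebra on the Hilbert space tensor product
generated by the operators `m ⊗ n`. -/
def tensor (M N : WStar.{u}) : WStar.{u} where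
  space := HilbertTensor M.space N.space
  alg := vnGenerated {T | ∃ (m : M.Carrier) (n : N.Carrier),
    T = tensorOp (m : M.space →L[ℂ] M.space) (n : N.space →L[ℂ] N.space)}

/-- The element `m ⊗ n` of the spatial tensor product. -/
def tmul {M N : WStar.{u}} (m : M.Carrier) (n : N.Carrier) : (tensor M N).Carrier :=
  ⟨tensorOp (m : M.space →L[ℂ] M.space) (n : N.space →L[ℂ] N.space),
    subset_vnGenerated _ ⟨m, n, rfl⟩⟩

/-- `τ = π ⊗ ρ` as a morphism of spatial tensor products. Such a morphism always exists, and it is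
determined by this property, since the elements `m ⊗ n` generate the spatial tensor product. -/
def IsTensorHom {M₀ M₁ N₀ N₁ : WStar.{u}} (π : M₀ ⟶ M₁) (ρ : N₀ ⟶ N₁)
    (τ : tensor M₀ N₀ ⟶ tensor M₁ N₁) : Prop :=
  ∀ (m : M₀.Carrier) (n : N₀.Carrier),
    Hom.toFun τ (tmul m n) = tmul (Hom.toFun π m) (Hom.toFun ρ n)

/-- `(E, ε)` is a free exponential of `M` and `N`: every morphism `π : M ⟶ R ⊗ N` is of the form
`(ρ ⊗ 1) ∘ ε` for a unique morphism `ρ : E ⟶ R`. -/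
def IsFreeExponential {M N E : WStar.{u}} (ε : M ⟶ tensor E N) : Prop :=
  ∀ (R : WStar.{u}) (π : M ⟶ tensor R N),
    ∃! ρ : E ⟶ R, ∃ τ : tensor E N ⟶ tensor R N, IsTensorHom ρ (𝟙 N) τ ∧ ε ≫ τ = π

/-- `h : E ⟶ E'` is the morphism of free exponentials induced by `f : M ⟶ M'` and `g : N' ⟶ N`,
that is, `(h ⊗ 1) ∘ ε = (1 ⊗ g) ∘ ε' ∘ f`. -/
def IsInducedHom {M M' N N' E E' : WStar.{u}} (ε : M ⟶ tensor E N) (ε' : M' ⟶ tensor E' N')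
    (f : M ⟶ M') (g : N' ⟶ N) (h : E ⟶ E') : Prop :=
  ∃ (τ : tensor E N ⟶ tensor E' N) (σ : tensor E' N' ⟶ tensor E' N),
    IsTensorHom h (𝟙 N) τ ∧ IsTensorHom (𝟙 E') g σ ∧ ε ≫ τ = f ≫ ε' ≫ σ

end WStar

section DirectSum

variable {I : Type u} {K : I → Type v} [∀ i, NormedAddCommGroup (K i)]
  [∀ i, InnerProductSpace ℂ (K i)]

open Classical in
/-- The inclusion of the `i`-th summand of an `ℓ²`-direct sum. -/
def inclL (K : I → Type v) [∀ i, NormedAddCommGroup (K i)]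
    [∀ i, InnerProductSpace ℂ (K i)] (i : I) : K i →L[ℂ] lp K 2 :=
  lp.singleContinuousLinearMap ℂ K 2 i

/-- The `i`-th coordinate on an `ℓ²`-direct sum. -/
def coordL (K : I → Type v) [∀ i, NormedAddCommGroup (K i)]
    [∀ i, InnerProductSpace ℂ (K i)] (i : I) : lp K 2 →L[ℂ] K i :=
  lp.evalCLM ℂ K 2 i

theorem coordL_apply (i : I) (v : lp K 2) : coordL K i v = v i := rfl

theorem inclL_self (i : I) (x : K i) : (inclL K i x) i = x := by
  classical
  simp [inclL, lp.singleContinuousLinearMap_apply]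

theorem inclL_ne {i j : I} (h : j ≠ i) (x : K i) : (inclL K i x) j = 0 := by
  classical
  simp [inclL, lp.singleContinuousLinearMap_apply, h]

theorem inner_inclL_left (i : I) (x : K i) (v : lp K 2) :
    inner ℂ (inclL K i x) v = inner ℂ x (v i) := by
  classical
  simp [inclL, lp.singleContinuousLinearMap_apply, lp.inner_single_left]

theorem inner_inclL_right (i : I) (x : K i) (v : lp K 2) :
    inner ℂ v (inclL K i x) = inner ℂ (v i) x := by
  classical
  simp [inclL, lp.singleContinuousLinearMap_apply, lp.inner_single_right]

/-- The `i`-th entry of an operator on the `ℓ²`-direct sum. -/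
def entry (i : I) (T : lp K 2 →L[ℂ] lp K 2) : K i →L[ℂ] K i :=
  coordL K i ∘L T ∘L inclL K i

theorem entry_apply (i : I) (T : lp K 2 →L[ℂ] lp K 2) (x : K i) :
    entry i T x = (T (inclL K i x)) i := rfl

variable [∀ i, CompleteSpace (K i)]

/-- `T` is the diagonal operator on the `ℓ²`-direct sum with entries `mᵢ ∈ N i`. -/
def IsDiagonal (N : ∀ i, VonNeumannAlgebra (K i)) (T : lp K 2 →L[ℂ] lp K 2) : Prop :=
  ∀ i, ∃ m ∈ N i, ∀ v : lp K 2, (T v) i = m (v i)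

theorem IsDiagonal.comm {N : ∀ i, VonNeumannAlgebra (K i)} {T : lp K 2 →L[ℂ] lp K 2}
    (hT : IsDiagonal N T) (i : I) {b : K i →L[ℂ] K i}
    (hb : b ∈ Set.centralizer (N i : Set (K i →L[ℂ] K i))) :
    T * (inclL K i ∘L b ∘L coordL K i) = (inclL K i ∘L b ∘L coordL K i) * T := by
  ext v j
  obtain ⟨m, hm, h⟩ := hT j
  change (T (inclL K i (b (v i)))) j = (inclL K i (b ((T v) i))) j
  rw [h]
  by_cases hij : j = i
  · subst hij
    rw [inclL_self, inclL_self, h]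
    exact congrArg (fun S : K j →L[ℂ] K j => S (v j)) (hb m hm)
  · rw [inclL_ne hij, inclL_ne hij, map_zero]

theorem isDiagonal_of_comm {N : ∀ i, VonNeumannAlgebra (K i)} {T : lp K 2 →L[ℂ] lp K 2}
    (hT : ∀ (i : I) (b : K i →L[ℂ] K i), b ∈ Set.centralizer (N i : Set (K i →L[ℂ] K i)) →
      (inclL K i ∘L b ∘L coordL K i) * T = T * (inclL K i ∘L b ∘L coordL K i)) :
    IsDiagonal N T := by
  intro i
  have key : ∀ b ∈ Set.centralizer (N i : Set (K i →L[ℂ] K i)), ∀ v : lp K 2,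
      b ((T v) i) = (T (inclL K i (b (v i)))) i := by
    intro b hb v
    have h := congrArg (fun S : lp K 2 →L[ℂ] lp K 2 => (S v) i) (hT i b hb)
    change (inclL K i (b ((T v) i))) i = (T (inclL K i (b (v i)))) i at h
    rwa [inclL_self] at h
  refine ⟨coordL K i ∘L T ∘L inclL K i, ?_, fun v => ?_⟩
  · rw [← SetLike.mem_coe, ← VonNeumannAlgebra.centralizer_centralizer (N i)]
    intro b hb
    ext x
    change b ((T (inclL K i x)) i) = (T (inclL K i (b x))) i
    rw [key b hb, inclL_self]
  · have h := key 1 (by intro a _; simp) v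
    simpa [coordL_apply] using h

/-- The direct sum of von Neumann algebras `N i` on `K i`: the algebra of all (bounded) diagonal
operators with entries in the `N i`, acting on the `ℓ²`-direct sum of the `K i`. -/
def directSumAlg (N : ∀ i, VonNeumannAlgebra (K i)) : VonNeumannAlgebra (lp K 2) where
  carrier := {T | IsDiagonal N T}
  mul_mem' := by
    intro S T hS hT i
    obtain ⟨a, ha, h⟩ := hS i
    obtain ⟨b, hb, h'⟩ := hT i
    refine ⟨a * b, mul_mem ha hb, fun v => ?_⟩
    change (S (T v)) i = a (b (v i))
    rw [h, h']
  add_mem' := by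
    intro S T hS hT i
    obtain ⟨a, ha, h⟩ := hS i
    obtain ⟨b, hb, h'⟩ := hT i
    refine ⟨a + b, add_mem ha hb, fun v => ?_⟩
    change (S v) i + (T v) i = a (v i) + b (v i)
    rw [h, h']
  algebraMap_mem' := by
    intro c i
    refine ⟨algebraMap ℂ _ c, (N i).toStarSubalgebra.algebraMap_mem c, fun v => ?_⟩
    simp [Algebra.algebraMap_eq_smul_one]
  star_mem' := by
    intro T hT i
    obtain ⟨a, ha, h⟩ := hT i
    refine ⟨star a, star_mem ha, fun v => ?_⟩
    refine ext_inner_left ℂ fun x => ?_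
    have hx : T (inclL K i x) = inclL K i (a x) := by
      ext j
      by_cases hij : j = i
      · subst hij
        rw [h, inclL_self, inclL_self]
      · obtain ⟨c, -, hc⟩ := hT j
        rw [hc, inclL_ne hij, inclL_ne hij, map_zero]
    rw [← inner_inclL_left, ContinuousLinearMap.star_eq_adjoint,
      ContinuousLinearMap.star_eq_adjoint, ContinuousLinearMap.adjoint_inner_right,
      ContinuousLinearMap.adjoint_inner_right, hx, inner_inclL_left]
  centralizer_centralizer' := by
    refine Set.Subset.antisymm (fun T hT => ?_) Set.subset_centralizer_centralizer
    refine isDiagonal_of_comm fun i b hb => hT _ ?_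
    intro S hS
    exact IsDiagonal.comm hS i hb

theorem mem_directSumAlg {N : ∀ i, VonNeumannAlgebra (K i)} {T : lp K 2 →L[ℂ] lp K 2} :
    T ∈ (directSumAlg N).toStarSubalgebra ↔ IsDiagonal N T := Iff.rfl

theorem IsDiagonal.entry_mem {N : ∀ i, VonNeumannAlgebra (K i)} {T : lp K 2 →L[ℂ] lp K 2}
    (hT : IsDiagonal N T) (i : I) : entry i T ∈ (N i).toStarSubalgebra := by
  obtain ⟨m, hm, h⟩ := hT i
  have : entry i T = m := by
    ext x
    rw [entry_apply, h, inclL_self]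
  rw [this]
  exact hm

theorem IsDiagonal.apply_eq {N : ∀ i, VonNeumannAlgebra (K i)} {T : lp K 2 →L[ℂ] lp K 2}
    (hT : IsDiagonal N T) (i : I) (v : lp K 2) : (T v) i = entry i T (v i) := by
  obtain ⟨m, hm, h⟩ := hT i
  rw [entry_apply, h, h, inclL_self]

/-- The `i`-th projection of the direct sum, as a unital `*`-homomorphism. -/
def entryHom (N : ∀ i, VonNeumannAlgebra (K i)) (i : I) :
    (directSumAlg N).toStarSubalgebra →⋆ₐ[ℂ] (N i).toStarSubalgebra where
  toFun T := ⟨entry i (T : lp K 2 →L[ℂ] lp K 2), IsDiagonal.entry_mem T.2 i⟩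
  map_one' := by
    ext x
    exact inclL_self i x
  map_mul' S T := by
    ext x
    change ((S : lp K 2 →L[ℂ] lp K 2) ((T : lp K 2 →L[ℂ] lp K 2) (inclL K i x))) i = _
    rw [IsDiagonal.apply_eq S.2]
    rfl
  map_zero' := by
    ext x
    rfl
  map_add' S T := by
    ext x
    rfl
  commutes' c := by
    ext x
    change ((algebraMap ℂ (lp K 2 →L[ℂ] lp K 2) c) (inclL K i x)) i =
      (algebraMap ℂ (K i →L[ℂ] K i) c) x
    simp [Algebra.algebraMap_eq_smul_one, inclL_self]
  map_star' T := by
    ext x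
    refine ext_inner_left ℂ fun y => ?_
    change inner ℂ y ((star (T : lp K 2 →L[ℂ] lp K 2) (inclL K i x)) i) =
      inner ℂ y (star (entry i (T : lp K 2 →L[ℂ] lp K 2)) x)
    rw [← inner_inclL_left, ContinuousLinearMap.star_eq_adjoint,
      ContinuousLinearMap.star_eq_adjoint, ContinuousLinearMap.adjoint_inner_right,
      ContinuousLinearMap.adjoint_inner_right, inner_inclL_right, entry_apply]

end DirectSum

/-- The square-summable sequence obtained by including a square-summable sequence in `K i` into the
`ℓ²`-direct sum. -/
def inclSeq {I : Type u} (K : I → Type v) [∀ i, NormedAddCommGroup (K i)]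
    [∀ i, InnerProductSpace ℂ (K i)] (i : I) (ξ : lp (fun _ : ℕ => K i) 2) :
    lp (fun _ : ℕ => lp K 2) 2 :=
  ⟨fun n => inclL K i (ξ n), by
    classical
    have h := lp.memℓp ξ
    change Memℓp (fun n => inclL K i (ξ n)) 2
    rw [memℓp_gen_iff (by norm_num)] at h ⊢
    simpa [inclL, lp.singleContinuousLinearMap_apply, lp.norm_single] using h⟩

namespace WStar

/-- The direct sum of a family of `W*`-algebras. -/
def directSum {I : Type u} (N : I → WStar.{u}) : WStar.{u} where
  space := lp (fun i => (N i).space) 2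
  alg := directSumAlg fun i => (N i).alg

/-- The projection of a direct sum onto its `i`-th summand. -/
def proj {I : Type u} (N : I → WStar.{u}) (i : I) : directSum N ⟶ N i where
  toFun := entryHom (fun i => (N i).alg) i
  normal := by
    let _ := (directSum N).weakStar
    let _ := (N i).weakStar
    refine continuous_induced_rng.2 (continuous_pi fun p => ?_)
    have h := (continuous_apply (A := fun _ : lp (fun _ : ℕ => (directSum N).space) 2 ×
        lp (fun _ : ℕ => (directSum N).space) 2 => ℂ)
      (inclSeq (fun i => (N i).space) i p.1, inclSeq (fun i => (N i).space) i p.2)).comp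
      (continuous_induced_dom (f := fun (a : (directSum N).Carrier)
        (p : lp (fun _ : ℕ => (directSum N).space) 2 ×
          lp (fun _ : ℕ => (directSum N).space) 2) =>
        ∑' n, inner ℂ (p.1 n) ((a : (directSum N).space →L[ℂ] (directSum N).space) (p.2 n))))
    refine h.congr fun a => tsum_congr fun n => ?_
    exact inner_inclL_left i _ _

/-- The von Neumann algebra `ℂ`, acting on the Hilbert space `ℂ`. -/
def complexAlg : VonNeumannAlgebra ℂ where
  toStarSubalgebra := ⊤
  centralizer_centralizer' :=
    Set.Subset.antisymm (Set.subset_univ _) Set.subset_centralizer_centralizer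

/-- The `W*`-algebra `ℓ^∞(X)` of bounded functions on `X`, acting on `ℓ²(X)` by multiplication:
the direct sum of copies of `ℂ` indexed by `X`. -/
def linfty (X : Type u) : WStar.{u} where
  space := lp (fun _ : X => ℂ) 2
  alg := directSumAlg fun _ => complexAlg

/-- The value at `x` of an element of `ℓ^∞(X)`. -/
def linftyApply {X : Type u} (f : (linfty X).Carrier) (x : X) : ℂ :=
  entry (K := fun _ : X => ℂ) x (f : (linfty X).space →L[ℂ] (linfty X).space) 1

/-- `τ : F ⊗ ℓ^∞(X) ⟶ F` is evaluation at `x`, that is, `1 ⊗ evₓ` followed by `F ⊗ ℂ ≅ F`. Such a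
morphism always exists, and it is determined by this property. -/
def IsEvalHom {X : Type u} {F : WStar.{u}} (x : X) (τ : tensor F (linfty X) ⟶ F) : Prop :=
  ∀ (a : F.Carrier) (f : (linfty X).Carrier), Hom.toFun τ (tmul a f) = linftyApply f x • a

/-- Compatibility of morphisms `kᵢ : E i ⟶ F` with `εᵢ : M ⟶ E i ⊗ N i` and `η : M ⟶ F ⊗ ⨁ᵢ N i`:
`(kᵢ ⊗ 1) ∘ εᵢ = (1 ⊗ pᵢ) ∘ η` for every `i`, where `pᵢ` is the projection of the direct sum. -/
def IsCompatible {M : WStar.{u}} {I : Type u} {N E : I → WStar.{u}} {F : WStar.{u}}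
    (ε : ∀ i, M ⟶ tensor (E i) (N i)) (η : M ⟶ tensor F (directSum N))
    (k : ∀ i, E i ⟶ F) : Prop :=
  ∀ i, ∃ (τ : tensor (E i) (N i) ⟶ tensor F (N i))
    (σ : tensor F (directSum N) ⟶ tensor F (N i)),
    IsTensorHom (k i) (𝟙 (N i)) τ ∧ IsTensorHom (𝟙 F) (proj N i) σ ∧ ε i ≫ τ = η ≫ σ

/-- Compatibility of morphisms `kₓ : M ⟶ F` with `η : M ⟶ F ⊗ ℓ^∞(X)`: for every `x`, the morphism
`kₓ` is `η` followed by evaluation at `x`. -/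
def IsCompatibleEval {M F : WStar.{u}} {X : Type u} (η : M ⟶ tensor F (linfty X))
    (k : X → (M ⟶ F)) : Prop :=
  ∀ x, ∃ τ : tensor F (linfty X) ⟶ F, IsEvalHom x τ ∧ η ≫ τ = k x

end WStar

end FreeExp

end

open FreeExp FreeExp.WStar

/-! A free exponential of `M` and `N` is a universal arrow from `M` to the functor `- ⊗ N`. Suppose
a functor `T` is the pointwise product of functors `T' i`. A morphism `M ⟶ T R` is then a family of
morphisms `M ⟶ T' i R`, hence, by universality, a family of morphisms `E i ⟶ R`, hence a single
morphism to `R` from the coproduct of the `E i`. So that coproduct carries a universal arrow to `T`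
(`IsPointwiseProduct.isUniversalArrow`). This applies twice: `R ⊗ ⨁ N i` is the product of the `R ⊗
N i`, and `R ⊗ ℓ^∞(X)` is the product of copies of `R`, where `𝟙 M` is the universal arrow to the
identity functor. Canonical isomorphisms and naturality (`comp_desc_eq_of_natTrans`) are then
formal.

What remains is analytic: tensor products of normal morphisms exist and are determined on elementary
tensors, the tensor product distributes over direct sums, and direct sums are categorical products.
All of it rests on the spatial form of a normal morphism `f : A ⟶ B`: there is an isometry `V` from
the space of `B` into a multiple of the space of `A` that turns `f x` into the amplification of `x`
(`Hom.exists_implements`). Conversely, such isometries produce normal morphisms as soon as their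
range is suitably invariant under generators (`exists_hom_of_isometry`). An operator that
intertwines the amplified generators intertwines the whole algebra, so morphisms are determined by
generators.

For the spatial form, continuity at `0` of `x ↦ ⟪ξ, f x ξ⟫` bounds `‖f x ξ‖` by a constant times `‖x
ζ‖` for one vector `ζ` of a multiple. The absolute value of the resulting intertwiner improves the
bound to an equality of Gram matrices, and Zorn's lemma assembles the cyclic pieces. -/

noncomputable section

namespace FreeExp

/-- The `ℓ²`-direct sum of copies of `H` indexed by `J`. -/
abbrev Ell2 (J : Type*) (H : Type*) [NormedAddCommGroup H] : Type _ := lp (fun _ : J => H) 2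

/-! ### Operators constructed from Gram matrices and norm bounds. -/

section Hilbert

variable {H : Type*} [NormedAddCommGroup H] [InnerProductSpace ℂ H]
  {K : Type*} [NormedAddCommGroup K] [InnerProductSpace ℂ K]

theorem memℓp_two_iff {J : Type*} {G : J → Type*} [∀ j, NormedAddCommGroup (G j)]
    {f : ∀ j, G j} : Memℓp f 2 ↔ Summable fun j => ‖f j‖ ^ 2 := by
  rw [memℓp_gen_iff (by norm_num)]
  norm_num

theorem norm_sq_eq_tsum {J : Type*} {G : J → Type*} [∀ j, NormedAddCommGroup (G j)]
    (v : lp G 2) : ‖v‖ ^ 2 = ∑' j, ‖v j‖ ^ 2 := by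
  have := lp.norm_rpow_eq_tsum (p := 2) (by norm_num) v
  norm_num at this
  exact this

/-- A linear map defined on a dense span is determined by the Gram matrix up to isometry. -/
theorem exists_linearIsometry_of_gram [CompleteSpace K] {ι : Type*} (a : ι → H) (b : ι → K)
    (ha : (Submodule.span ℂ (Set.range a)).topologicalClosure = ⊤)
    (h : ∀ i j, inner ℂ (a i) (a j) = inner ℂ (b i) (b j)) :
    ∃ V : H →ₗᵢ[ℂ] K, ∀ i, V (a i) = b i := by
  -- Both norms expand through the same Gram matrix; this is what makes `a i ↦ b i` well defined and
  -- isometric on the span.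
  have key : ∀ c : ι →₀ ℂ,
      ‖Finsupp.linearCombination ℂ b c‖ = ‖Finsupp.linearCombination ℂ a c‖ := by
    intro c
    have : inner ℂ (Finsupp.linearCombination ℂ b c) (Finsupp.linearCombination ℂ b c) =
        inner ℂ (Finsupp.linearCombination ℂ a c) (Finsupp.linearCombination ℂ a c) := by
      simp only [Finsupp.linearCombination_apply, Finsupp.sum, sum_inner, inner_sum,
        inner_smul_left, inner_smul_right, h]
    rw [@norm_eq_sqrt_re_inner ℂ, @norm_eq_sqrt_re_inner ℂ, this]
  have hd : DenseRange (Finsupp.linearCombination ℂ a) := by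
    rw [DenseRange, ← LinearMap.coe_range, Finsupp.range_linearCombination,
      Submodule.dense_iff_topologicalClosure_eq_top, ha]
  have hb : ∀ x, ‖Finsupp.linearCombination ℂ b x‖ ≤ 1 * ‖Finsupp.linearCombination ℂ a x‖ :=
    fun x => by rw [one_mul, key]
  have heq := LinearMap.extendOfNorm_eq hd ⟨1, hb⟩
  refine ⟨⟨((Finsupp.linearCombination ℂ b).extendOfNorm (Finsupp.linearCombination ℂ a)),
    fun x => ?_⟩, fun i => ?_⟩
  · refine hd.induction_on (p := fun x => ‖(Finsupp.linearCombination ℂ b).extendOfNorm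
      (Finsupp.linearCombination ℂ a) x‖ = ‖x‖) x
      (isClosed_eq (by fun_prop) (by fun_prop)) fun c => ?_
    rw [heq, key]
  · have := heq (Finsupp.single i 1)
    simpa using this

/-- A linear map dominated by another one factors through it by a bounded operator, which may be
chosen to vanish on the orthogonal complement of the range. -/
theorem exists_factor_of_norm_le [CompleteSpace H] [CompleteSpace K] {X : Type*} [AddCommGroup X]
    [Module ℂ X] (a : X →ₗ[ℂ] H) (b : X →ₗ[ℂ] K) (C : ℝ) (h : ∀ x, ‖b x‖ ≤ C * ‖a x‖) :
    ∃ w : H →L[ℂ] K, (∀ x, w (a x) = b x) ∧ ∀ v, (∀ x, inner ℂ (a x) v = 0) → w v = 0 := by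
  -- The map is extended by density to `D` only, then composed with the projection onto `D`; this
  -- forces it to vanish on `Dᗮ`.
  let D := (LinearMap.range a).topologicalClosure
  have hD : ∀ x, a x ∈ D := fun x => Submodule.le_topologicalClosure _ ⟨x, rfl⟩
  have : CompleteSpace D := (Submodule.isClosed_topologicalClosure _).completeSpace_coe
  let a' : X →ₗ[ℂ] D := a.codRestrict D hD
  have hd : DenseRange a' := by
    intro y
    rw [closure_subtype]
    have : (Subtype.val '' Set.range a' : Set H) = LinearMap.range a := by
      ext z
      constructor
      · rintro ⟨_, ⟨x, rfl⟩, rfl⟩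
        exact ⟨x, rfl⟩
      · rintro ⟨x, rfl⟩
        exact ⟨a' x, ⟨x, rfl⟩, rfl⟩
    rw [this]
    exact y.2
  have heq := LinearMap.extendOfNorm_eq (f := b) (e := a') hd ⟨C, h⟩
  refine ⟨(b.extendOfNorm a') ∘L D.orthogonalProjectionOnto, fun x => ?_, fun v hv => ?_⟩
  · have : D.orthogonalProjectionOnto (a x) = a' x :=
      Submodule.orthogonalProjectionOnto_mem_subspace_eq_self (K := D) (a' x)
    rw [ContinuousLinearMap.comp_apply, this, heq]
  · have : v ∈ Dᗮ := by
      rw [Submodule.orthogonal_closure, Submodule.mem_orthogonal]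
      rintro _ ⟨x, rfl⟩
      exact hv x
    rw [ContinuousLinearMap.comp_apply,
      Submodule.orthogonalProjectionOnto_eq_zero_iff.2 this, map_zero]

end Hilbert

/-! ### Amplification of operators to multiples of a Hilbert space. -/

section Amplification

variable {H : Type*} [NormedAddCommGroup H] [InnerProductSpace ℂ H]
  {K : Type*} [NormedAddCommGroup K] [InnerProductSpace ℂ K]
  {J : Type*}

theorem memℓp_map (T : H →L[ℂ] K) (v : Ell2 J H) : Memℓp (fun j => T (v j)) 2 :=
  Memℓp.mono' ((lp.memℓp v).const_smul (‖T‖ : ℂ)) fun j => by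
    simpa [norm_smul] using T.le_opNorm (v j)

/-- The diagonal operator all of whose entries are `T`. -/
def amp (J : Type*) (T : H →L[ℂ] K) : Ell2 J H →L[ℂ] Ell2 J K :=
  LinearMap.mkContinuous
    { toFun := fun v => ⟨fun j => T (v j), memℓp_map T v⟩
      map_add' := fun v w => by ext j; exact map_add T _ _
      map_smul' := fun c v => by ext j; exact map_smul T _ _ } ‖T‖ fun v => by
    have : ‖((‖T‖ : ℂ) • v : Ell2 J H)‖ = ‖T‖ * ‖v‖ := by rw [norm_smul]; simp
    rw [← this]
    refine lp.norm_mono (by norm_num) fun j => ?_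
    rw [lp.coeFn_smul, Pi.smul_apply, norm_smul]
    simpa using T.le_opNorm (v j)

@[simp]
theorem amp_apply (T : H →L[ℂ] K) (v : Ell2 J H) (j : J) : amp J T v j = T (v j) := rfl

theorem amp_mul (S T : H →L[ℂ] H) (v : Ell2 J H) : amp J (S * T) v = amp J S (amp J T v) := rfl

theorem amp_inclL (T : H →L[ℂ] K) (j : J) (x : H) :
    amp J T (inclL (fun _ => H) j x) = inclL (fun _ => K) j (T x) := by
  ext i
  rw [amp_apply]
  by_cases h : i = j
  · subst h
    rw [inclL_self, inclL_self]
  · rw [inclL_ne h, inclL_ne h, map_zero]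

theorem inner_amp_left [CompleteSpace H] (T : H →L[ℂ] H) (v w : Ell2 J H) :
    inner ℂ (amp J T v) w = inner ℂ v (amp J (star T) w) := by
  rw [lp.inner_eq_tsum, lp.inner_eq_tsum]
  refine tsum_congr fun j => ?_
  rw [amp_apply, amp_apply, ContinuousLinearMap.star_eq_adjoint,
    ContinuousLinearMap.adjoint_inner_right]

theorem inner_amp_right [CompleteSpace H] (T : H →L[ℂ] H) (v w : Ell2 J H) :
    inner ℂ v (amp J T w) = inner ℂ (amp J (star T) v) w := by
  rw [inner_amp_left, star_star]

theorem ext_inclL {J : Type*} {G : J → Type*} [∀ j, NormedAddCommGroup (G j)]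
    [∀ j, InnerProductSpace ℂ (G j)] {f g : lp G 2 →L[ℂ] K}
    (h : ∀ j x, f (inclL G j x) = g (inclL G j x)) : f = g := by
  classical
  refine lp.ext_continuousLinearMap (by norm_num) fun j => ?_
  ext x
  have := h j x
  unfold inclL at this
  convert! this

end Amplification

/-! ### Generating sets and commutants. -/

section Generating

variable {H : Type*} [NormedAddCommGroup H] [InnerProductSpace ℂ H] [CompleteSpace H]

/-- `S` is a self-adjoint subset of `A` that generates `A` as a von Neumann algebra. -/
structure IsGenerating (S : Set (H →L[ℂ] H)) (A : VonNeumannAlgebra H) : Prop where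
  subset : ∀ s ∈ S, s ∈ A.toStarSubalgebra
  star_mem : ∀ s ∈ S, star s ∈ S
  comm : ∀ c : H →L[ℂ] H, (∀ s ∈ S, c * s = s * c) → ∀ T ∈ A.toStarSubalgebra, c * T = T * c

theorem IsGenerating.self (A : VonNeumannAlgebra H) :
    IsGenerating (A.toStarSubalgebra : Set (H →L[ℂ] H)) A :=
  ⟨fun _ h => h, fun _ h => StarMemClass.star_mem h, fun _ h => h⟩

theorem isGenerating_vnGenerated {S : Set (H →L[ℂ] H)} (hS : ∀ s ∈ S, star s ∈ S) :
    IsGenerating S (vnGenerated S) := by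
  refine ⟨fun s hs => subset_vnGenerated S hs, hS, fun c hc T hT => ?_⟩
  refine hT c (Or.inl ?_)
  rintro m (hm | hm)
  · exact (hc m hm).symm
  · exact (hc m (by simpa using hS _ hm)).symm

theorem mem_of_forall_commute {A : VonNeumannAlgebra H}
    {T : H →L[ℂ] H} (h : ∀ c, (∀ a ∈ A.toStarSubalgebra, c * a = a * c) → c * T = T * c) :
    T ∈ A.toStarSubalgebra := by
  change T ∈ (A : Set (H →L[ℂ] H))
  rw [← VonNeumannAlgebra.centralizer_centralizer A]
  intro c hc
  exact h c fun a ha => (hc a ha).symm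

/-- Each matrix entry of `W` is an operator on `H` commuting with `S`, hence with all of `A`. No
commutant of the amplified algebra has to be computed. -/
theorem IsGenerating.comm_amp {S : Set (H →L[ℂ] H)} {A : VonNeumannAlgebra H}
    (hS : IsGenerating S A) {I J : Type*} (W : Ell2 I H →L[ℂ] Ell2 J H)
    (hW : ∀ s ∈ S, ∀ v, W (amp I s v) = amp J s (W v)) {T : H →L[ℂ] H}
    (hT : T ∈ A.toStarSubalgebra) (v : Ell2 I H) : W (amp I T v) = amp J T (W v) := by
  suffices W ∘L amp I T = amp J T ∘L W from congrArg (fun f => f v) this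
  refine ext_inclL fun i x => ?_
  ext j
  change W (amp I T (inclL _ i x)) j = T (W (inclL _ i x) j)
  rw [amp_inclL]
  have := hS.comm (coordL (fun _ : J => H) j ∘L W ∘L inclL (fun _ : I => H) i) (fun s hs => by
    ext y
    change W (inclL _ i (s y)) j = s (W (inclL _ i y) j)
    rw [← amp_inclL, hW s hs]
    rfl) T hT
  exact congrArg (fun f => f x) this

end Generating

end FreeExp

end
-- From intertwining isometries to normal morphisms.
noncomputable section

namespace FreeExp

section Extend

set_option linter.unusedSectionVars false

variable {H : Type*} [NormedAddCommGroup H] [InnerProductSpace ℂ H]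
  {K : Type*} [NormedAddCommGroup K] [InnerProductSpace ℂ K] {I J : Type*}

/-- Extension by zero of a square-summable family along an injection. -/
def extendVec (e : I ↪ J) (v : Ell2 I H) : Ell2 J H :=
  ⟨Function.extend e v 0, by
    have h := memℓp_two_iff.1 (lp.memℓp v)
    refine memℓp_two_iff.2 ?_
    rw [← summable_extend_zero e.injective] at h
    refine h.congr fun j => ?_
    by_cases hj : ∃ i, e i = j
    · obtain ⟨i, rfl⟩ := hj
      simp [e.injective.extend_apply]
    · simp [Function.extend_apply' _ _ _ hj]⟩

@[simp]
theorem extendVec_apply (e : I ↪ J) (v : Ell2 I H) (i : I) : extendVec e v (e i) = v i :=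
  e.injective.extend_apply _ _ _

theorem extendVec_of_notMem (e : I ↪ J) (v : Ell2 I H) {j : J} (h : ¬∃ i, e i = j) :
    extendVec e v j = 0 :=
  Function.extend_apply' _ _ _ h

theorem amp_extendVec (e : I ↪ J) (T : H →L[ℂ] K) (v : Ell2 I H) :
    amp J T (extendVec e v) = extendVec e (amp I T v) := by
  ext j
  by_cases hj : ∃ i, e i = j
  · obtain ⟨i, rfl⟩ := hj
    simp
  · rw [amp_apply, extendVec_of_notMem _ _ hj, extendVec_of_notMem _ _ hj, map_zero]

theorem inner_extendVec (e : I ↪ J) (v : Ell2 I H) (w : Ell2 J H) :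
    inner ℂ (extendVec e v) w = ∑' i, inner ℂ (v i) (w (e i)) := by
  rw [lp.inner_eq_tsum, ← tsum_extend_zero e.injective]
  refine tsum_congr fun j => ?_
  by_cases hj : ∃ i, e i = j
  · obtain ⟨i, rfl⟩ := hj
    simp [e.injective.extend_apply]
  · rw [extendVec_of_notMem _ _ hj, inner_zero_left, Function.extend_apply' _ _ _ hj]
    rfl

theorem inner_extendVec_extendVec (e : I ↪ J) (v w : Ell2 I H) :
    inner ℂ (extendVec e v) (extendVec e w) = inner ℂ v w := by
  rw [inner_extendVec, lp.inner_eq_tsum]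
  simp

/-- Concatenation of the images under an isometry of a square-summable family. -/
def flatten (V : K →ₗᵢ[ℂ] Ell2 J H) (ξ : Ell2 I K) : Ell2 (I × J) H :=
  ⟨fun p => V (ξ p.1) p.2, by
    refine memℓp_two_iff.2 ((summable_prod_of_nonneg fun p => by positivity).2 ⟨fun i => ?_, ?_⟩)
    · exact memℓp_two_iff.1 (lp.memℓp (V (ξ i)))
    · refine (memℓp_two_iff.1 (lp.memℓp ξ)).congr fun i => ?_
      rw [← V.norm_map]
      exact norm_sq_eq_tsum _⟩

theorem inner_flatten (V : K →ₗᵢ[ℂ] Ell2 J H) (T : H →L[ℂ] H) (ξ η : Ell2 I K) :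
    inner ℂ (flatten V ξ) (amp (I × J) T (flatten V η)) =
      ∑' i, inner ℂ (V (ξ i)) (amp J T (V (η i))) := by
  have h : Summable fun p : I × J => inner ℂ (V (ξ p.1) p.2) (T (V (η p.1) p.2)) :=
    lp.summable_inner (flatten V ξ) (amp (I × J) T (flatten V η))
  exact h.tsum_prod

end Extend

namespace WStar

/-- The topology is defined by sequences, while `J` may be uncountable. A square-summable `α` has
countable support, so the sum can be reindexed inside `ℕ`; values of `β` off that support do not
matter. -/
theorem continuous_inner_amp (A : WStar.{u}) {J : Type*} (α β : Ell2 J A.space) :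
    @Continuous _ _ A.weakStar _
      fun x : A.Carrier => inner ℂ α (amp J (x : A.space →L[ℂ] A.space) β) := by
  let _ := A.weakStar
  let s : Set J := Function.support fun j => ‖α j‖ ^ 2
  have hs : s.Countable := (memℓp_two_iff.1 (lp.memℓp α)).countable_support
  obtain ⟨e, he⟩ := hs.exists_injective_nat
  have hr : ∀ v : Ell2 J A.space, Memℓp (fun i : s => v i) 2 := fun v =>
    memℓp_two_iff.2 ((memℓp_two_iff.1 (lp.memℓp v)).comp_injective Subtype.val_injective)
  let r : Ell2 J A.space → Ell2 s A.space := fun v => ⟨_, hr v⟩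
  have h := (continuous_apply (A := fun _ : Ell2 ℕ A.space × Ell2 ℕ A.space => ℂ)
    (extendVec ⟨e, he⟩ (r α), extendVec ⟨e, he⟩ (r β))).comp
    (continuous_induced_dom (f := fun (a : A.Carrier) (p : Ell2 ℕ A.space × Ell2 ℕ A.space) =>
      ∑' n, inner ℂ (p.1 n) ((a : A.space →L[ℂ] A.space) (p.2 n))))
  refine h.congr fun x => ?_
  change inner ℂ (extendVec ⟨e, he⟩ (r α))
    (amp ℕ (x : A.space →L[ℂ] A.space) (extendVec ⟨e, he⟩ (r β))) = _
  rw [amp_extendVec, inner_extendVec_extendVec, lp.inner_eq_tsum, lp.inner_eq_tsum]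
  refine tsum_subtype_eq_of_support_subset
    (f := fun j => inner ℂ (α j) ((x : A.space →L[ℂ] A.space) (β j))) fun j hj => ?_
  rw [Function.mem_support] at hj ⊢
  intro h0
  apply hj
  have : α j = 0 := by simpa using h0
  rw [this, inner_zero_left]

theorem continuous_of_inner_amp {X : Type*} [TopologicalSpace X] {B : WStar.{u}}
    {f : X → B.Carrier}
    (hf : ∀ ξ η : Ell2 ℕ B.space,
      Continuous fun x => inner ℂ ξ (amp ℕ (f x : B.space →L[ℂ] B.space) η)) :
    @Continuous _ _ _ B.weakStar f := by
  let _ := B.weakStar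
  exact continuous_induced_rng.2 (continuous_pi fun p => hf p.1 p.2)

/-- The isometry `V` embeds the representation `f` of `A` on the space of `B` into a multiple of
the identity representation of `A`. -/
def Implements {A B : WStar.{u}} {J : Type*} (V : B.space →ₗᵢ[ℂ] Ell2 J A.space)
    (f : A.Carrier → B.Carrier) : Prop :=
  ∀ (x : A.Carrier) (v : B.space), V ((f x : B.space →L[ℂ] B.space) v) =
    amp J (x : A.space →L[ℂ] A.space) (V v)

/-- A unital `*`-homomorphism on `A` is obtained from an isometry into a multiple of the space of
`A` as soon as the range is invariant under a generating set. -/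
theorem exists_hom_of_isometry {A B : WStar.{u}} {J : Type*}
    (V : B.space →ₗᵢ[ℂ] Ell2 J A.space) {S : Set (A.space →L[ℂ] A.space)}
    (hS : IsGenerating S A.alg)
    (h : ∀ s ∈ S, ∃ b : B.Carrier, ∀ v, V ((b : B.space →L[ℂ] B.space) v) = amp J s (V v)) :
    ∃ f : A ⟶ B, Implements V (Hom.toFun f) := by
  let W : B.space →L[ℂ] Ell2 J A.space := V.toContinuousLinearMap
  let Wa : Ell2 J A.space →L[ℂ] B.space := ContinuousLinearMap.adjoint W
  have hWW : ∀ v, Wa (V v) = v := fun v => by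
    refine ext_inner_left ℂ fun u => ?_
    rw [ContinuousLinearMap.adjoint_inner_right]
    exact V.inner_map_map u v
  have hadj : ∀ s ∈ S, ∀ b : B.Carrier,
      (∀ v, V ((b : B.space →L[ℂ] B.space) v) = amp J s (V v)) → ∀ u,
      Wa (amp J (star s) u) = (star (b : B.space →L[ℂ] B.space)) (Wa u) := by
    intro s _ b hb u
    refine ext_inner_left ℂ fun v => ?_
    rw [ContinuousLinearMap.adjoint_inner_right, ← inner_amp_left,
      ContinuousLinearMap.star_eq_adjoint, ContinuousLinearMap.adjoint_inner_right,
      ContinuousLinearMap.adjoint_inner_right]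
    change inner ℂ (amp J s (V v)) u = inner ℂ (V _) u
    rw [hb]
  -- operators commuting with `B` lift to operators commuting with the amplification
  have hcomm : ∀ c : B.space →L[ℂ] B.space, (∀ b ∈ B.alg.toStarSubalgebra, c * b = b * c) →
      ∀ T ∈ A.alg.toStarSubalgebra, ∀ u, V (c (Wa (amp J T u))) = amp J T (V (c (Wa u))) := by
    intro c hc T hT u
    refine hS.comm_amp (W ∘L c ∘L Wa) (fun s hs v => ?_) hT u
    obtain ⟨b, hb⟩ := h (star s) (hS.star_mem s hs)
    obtain ⟨b', hb'⟩ := h s hs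
    have h1 := hadj (star s) (hS.star_mem s hs) b hb v
    rw [star_star] at h1
    change V (c (Wa (amp J s v))) = amp J s (V (c (Wa v)))
    -- `b` and `b'` are independent choices for `star s` and `s`; the left inverse `Wa` of `V`
    -- forces `star b = b'`.
    have hbb : star (b : B.space →L[ℂ] B.space) = b' := by
      ext v
      have h2 := hadj (star s) (hS.star_mem s hs) b hb (V v)
      rw [star_star, ← hb', hWW, hWW] at h2
      exact h2.symm
    rw [h1, hbb, ← hb']
    congr 1
    exact congrArg (fun f : B.space →L[ℂ] B.space => f (Wa v)) (hc b' b'.2)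
  -- Taking `c = 1` shows that the range projection `V Wa` fixes `amp J T (V v)`: the range is
  -- invariant under all of `A`, not only under `S`. Hence the compression `Φ` below is
  -- multiplicative.
  have hone : ∀ T ∈ A.alg.toStarSubalgebra, ∀ v, V (Wa (amp J T (V v))) = amp J T (V v) := by
    intro T hT v
    have := hcomm 1 (fun b _ => by rw [one_mul, mul_one]) T hT (V v)
    simpa [hWW] using this
  let Φ : A.Carrier → (B.space →L[ℂ] B.space) := fun x =>
    Wa ∘L amp J (x : A.space →L[ℂ] A.space) ∘L W
  have hΦ : ∀ x v, V (Φ x v) = amp J (x : A.space →L[ℂ] A.space) (V v) := fun x v => hone x x.2 v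
  -- By `hcomm`, `Φ x` commutes with the commutant of `B`, so the double commutant property applies.
  have hmem : ∀ x, Φ x ∈ B.alg.toStarSubalgebra := by
    intro x
    refine mem_of_forall_commute fun c hc => ?_
    ext v
    apply V.injective
    change V (c (Φ x v)) = V (Φ x (c v))
    rw [hΦ]
    have := hcomm c hc x x.2 (V v)
    rwa [hWW] at this
  refine ⟨⟨⟨⟨⟨⟨⟨fun x => ⟨Φ x, hmem x⟩, ?_⟩, ?_⟩, ?_, ?_⟩, ?_⟩, ?_⟩, ?_⟩, hΦ⟩
  · refine Subtype.ext (ContinuousLinearMap.ext fun v => V.injective ?_)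
    exact hΦ 1 v
  · intro x y
    refine Subtype.ext (ContinuousLinearMap.ext fun v => V.injective ?_)
    change V (Φ (x * y) v) = V (Φ x (Φ y v))
    rw [hΦ, hΦ, hΦ]
    rfl
  · refine Subtype.ext (ContinuousLinearMap.ext fun v => V.injective ?_)
    change V (Φ 0 v) = V 0
    rw [hΦ, V.map_zero]
    rfl
  · intro x y
    refine Subtype.ext (ContinuousLinearMap.ext fun v => V.injective ?_)
    change V (Φ (x + y) v) = V (Φ x v + Φ y v)
    rw [hΦ, V.map_add, hΦ, hΦ]
    rfl
  · intro c
    refine Subtype.ext (ContinuousLinearMap.ext fun v => V.injective ?_)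
    change V (Φ (algebraMap ℂ _ c) v) = V (c • v)
    rw [hΦ, V.map_smul]
    rfl
  · intro x
    refine Subtype.ext (ContinuousLinearMap.ext fun v => ext_inner_left ℂ fun u => ?_)
    change inner ℂ u (Φ (star x) v) = inner ℂ u (star (Φ x) v)
    rw [ContinuousLinearMap.star_eq_adjoint, ContinuousLinearMap.adjoint_inner_right,
      ← V.inner_map_map, ← V.inner_map_map, hΦ, hΦ, inner_amp_left]
    rfl
  · let _ := A.weakStar
    -- The functional on `B` given by `ξ`, `η` pulls back to the functional on `A` given by the
    -- flattened families `V ξ`, `V η`.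
    refine continuous_of_inner_amp fun ξ η => ?_
    refine (continuous_inner_amp A (flatten V ξ) (flatten V η)).congr fun x => ?_
    refine (inner_flatten V (x : A.space →L[ℂ] A.space) ξ η).trans (tsum_congr fun n => ?_)
    exact (congrArg (inner ℂ (V (ξ n))) (hΦ x (η n)).symm).trans (V.inner_map_map _ _)

end WStar

end FreeExp

end
-- The structure of normal representations.
noncomputable section

namespace FreeExp

section Restrict

set_option linter.unusedSectionVars false

variable {H : Type*} [NormedAddCommGroup H] [InnerProductSpace ℂ H] {I J : Type*}

theorem norm_le_of_comp_embedding (e : I ↪ J) {v : Ell2 I H} {w : Ell2 J H}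
    (h : ∀ i, ‖v i‖ = ‖w (e i)‖) : ‖v‖ ≤ ‖w‖ := by
  rw [← sq_le_sq₀ (norm_nonneg _) (norm_nonneg _), norm_sq_eq_tsum, norm_sq_eq_tsum]
  simp_rw [h]
  exact Summable.tsum_le_tsum_of_inj e e.injective (fun _ _ => by positivity) (fun _ => le_rfl)
    ((memℓp_two_iff.1 (lp.memℓp w)).comp_injective e.injective) (memℓp_two_iff.1 (lp.memℓp w))

/-- Finitely many square-summable families are dominated by a single one, uniformly over all
amplified operators. -/
theorem exists_dominating (T : Finset (Ell2 I H)) :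
    ∃ ζ : Ell2 (Ell2 I H × I) H, ∀ γ ∈ T, ∀ x : H →L[ℂ] H,
      ‖amp I x γ‖ ≤ ‖amp (Ell2 I H × I) x ζ‖ := by
  classical
  -- Indices are tagged by the vector itself, so the copies of distinct vectors have disjoint
  -- supports and their sum restricts to `γ` on the block of `γ`.
  let e : Ell2 I H → I ↪ Ell2 I H × I := fun γ =>
    ⟨fun n => (γ, n), fun m n h => (Prod.ext_iff.1 h).2⟩
  refine ⟨∑ γ ∈ T, extendVec (e γ) γ, fun γ hγ x => norm_le_of_comp_embedding (e γ) fun n => ?_⟩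
  have : (∑ γ ∈ T, extendVec (e γ) γ : Ell2 (Ell2 I H × I) H) (e γ n) = γ n := by
    rw [lp.coeFn_sum, Finset.sum_apply, Finset.sum_eq_single γ]
    · exact extendVec_apply _ _ _
    · intro γ' _ hne
      refine extendVec_of_notMem _ _ ?_
      rintro ⟨m, hm⟩
      exact hne (Prod.ext_iff.1 hm).1
    · exact fun h => (h hγ).elim
  rw [amp_apply, amp_apply, this]

end Restrict

/-- By homogeneity: if the bound failed at `x`, then `x` divided by `‖b x‖` would satisfy the
premise while its image under `b` has norm exactly `1`. -/
theorem norm_le_of_norm_lt_imp {X E F : Type*} [AddCommGroup X] [Module ℂ X]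
    [NormedAddCommGroup E] [NormedSpace ℂ E] [NormedAddCommGroup F] [NormedSpace ℂ F]
    (a : X →ₗ[ℂ] E) (b : X →ₗ[ℂ] F) {ε : ℝ} (hε : 0 < ε) (h : ∀ x, ‖a x‖ < ε → ‖b x‖ < 1) (x : X) :
    ‖b x‖ ≤ ε⁻¹ * ‖a x‖ := by
  by_contra! hlt
  have hb : 0 < ‖b x‖ := lt_of_le_of_lt (by positivity) hlt
  have := h (((‖b x‖⁻¹ : ℝ) : ℂ) • x) (by
    rw [map_smul, norm_smul, Complex.norm_real, norm_inv, norm_norm]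
    rw [inv_mul_lt_iff₀ hε] at hlt
    rw [inv_mul_lt_iff₀ hb]
    linarith)
  rw [map_smul, norm_smul, Complex.norm_real, norm_inv, norm_norm, inv_mul_cancel₀ hb.ne'] at this
  exact lt_irrefl _ this

/-- The positive square root of `w* w`, together with its commutation properties. -/
theorem exists_sqrt_commute {L K : Type*} [NormedAddCommGroup L] [InnerProductSpace ℂ L]
    [CompleteSpace L] [NormedAddCommGroup K] [InnerProductSpace ℂ K] [CompleteSpace K]
    (w : L →L[ℂ] K) :
    ∃ s : L →L[ℂ] L, (∀ u v, inner ℂ (s u) (s v) = inner ℂ (w u) (w v)) ∧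
      ∀ T T' : L →L[ℂ] L, (∀ u v, inner ℂ (T u) v = inner ℂ u (T' v)) →
        (∀ u v, inner ℂ (w (T u)) (w v) = inner ℂ (w u) (w (T' v))) → ∀ v, s (T v) = T (s v) := by
  let t : L →L[ℂ] L := ContinuousLinearMap.adjoint w ∘L w
  have ht : 0 ≤ t := by
    rw [ContinuousLinearMap.nonneg_iff_isPositive]
    exact ContinuousLinearMap.isPositive_adjoint_comp_self w
  have htinner : ∀ u v, inner ℂ (t u) v = inner ℂ (w u) (w v) := fun u v =>
    ContinuousLinearMap.adjoint_inner_left w v (w u)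
  let s := CFC.sqrt t
  refine ⟨s, fun u v => ?_, fun T T' hT h v => ?_⟩
  · have h1 : s * s = t := CFC.sqrt_mul_sqrt_self t ht
    have h2 : IsSelfAdjoint s := (CFC.sqrt_nonneg t).isSelfAdjoint
    rw [← htinner, ← h1, ← ContinuousLinearMap.adjoint_inner_left,
      ← ContinuousLinearMap.star_eq_adjoint, h2.star_eq]
    rfl
  -- The assumptions on `T` and `T'` say weakly that `t = w* w` commutes with `T`; the functional
  -- calculus passes this on to the square root.
  · have hcomm : Commute t T := by
      ext1 v
      refine ext_inner_right ℂ fun u => ?_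
      change inner ℂ (t (T v)) u = inner ℂ (T (t v)) u
      rw [htinner, h, hT, htinner]
    have : Commute s T := by
      have : s = cfcₙ NNReal.sqrt t := rfl
      rw [this]
      exact hcomm.cfcₙ_nnreal _
    exact congrArg (fun g : L →L[ℂ] L => g v) this

namespace WStar

variable {A B : WStar.{u}}

/-- The orbit map `x ↦ x ζ` on a multiple of the identity representation. -/
def ampOrbit {J : Type*} (ζ : Ell2 J A.space) : A.Carrier →ₗ[ℂ] Ell2 J A.space where
  toFun x := amp J (x : A.space →L[ℂ] A.space) ζ
  map_add' _ _ := rfl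
  map_smul' _ _ := rfl

/-- The orbit map `x ↦ f x ξ` of a representation. -/
def Hom.orbit (f : A ⟶ B) (ξ : B.space) : A.Carrier →ₗ[ℂ] B.space where
  toFun x := (Hom.toFun f x : B.space →L[ℂ] B.space) ξ
  map_add' x y := by rw [map_add]; rfl
  map_smul' c x := by rw [map_smul]; rfl

theorem Hom.apply_mul (f : A ⟶ B) (x y : A.Carrier) (ξ : B.space) :
    (Hom.toFun f (x * y) : B.space →L[ℂ] B.space) ξ =
      (Hom.toFun f x : B.space →L[ℂ] B.space) ((Hom.toFun f y : B.space →L[ℂ] B.space) ξ) := by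
  rw [map_mul]; rfl

theorem Hom.inner_apply_left (f : A ⟶ B) (x : A.Carrier) (ξ η : B.space) :
    inner ℂ ((Hom.toFun f x : B.space →L[ℂ] B.space) ξ) η =
      inner ℂ ξ ((Hom.toFun f (star x) : B.space →L[ℂ] B.space) η) := by
  rw [map_star]
  change _ = inner ℂ ξ (star (Hom.toFun f x : B.space →L[ℂ] B.space) η)
  rw [ContinuousLinearMap.star_eq_adjoint, ContinuousLinearMap.adjoint_inner_right]

theorem Hom.norm_sq_apply (f : A ⟶ B) (x : A.Carrier) (ξ : B.space) :
    inner ℂ ξ ((Hom.toFun f (star x * x) : B.space →L[ℂ] B.space) ξ) =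
      (‖(Hom.toFun f x : B.space →L[ℂ] B.space) ξ‖ : ℂ) ^ 2 := by
  rw [Hom.apply_mul, ← Hom.inner_apply_left, inner_self_eq_norm_sq_to_K]
  rfl

/-- Normality enters here. A `w*`-neighbourhood of `0` involves only finitely many vector pairs, and
`φ (star x * x) = ‖f x ξ‖ ^ 2`, so smallness of `x` on finitely many vectors, merged into a single
`ζ`, controls `f x ξ`. -/
theorem Hom.exists_orbit_le (f : A ⟶ B) (ξ : B.space) :
    ∃ (ζ : Ell2 (Ell2 ℕ A.space × ℕ) A.space) (C : ℝ),
      ∀ x, ‖f.orbit ξ x‖ ≤ C * ‖ampOrbit ζ x‖ := by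
  classical
  let φ : A.Carrier → ℂ := fun x => inner ℂ ξ ((Hom.toFun f x : B.space →L[ℂ] B.space) ξ)
  have hφ : @Continuous _ _ A.weakStar _ φ := by
    have h := @Continuous.comp _ _ _ A.weakStar B.weakStar _ _ _
      (continuous_inner_amp B (J := ℕ) (inclL (fun _ => B.space) 0 ξ) (inclL (fun _ => B.space) 0 ξ))
      (Hom.normal f)
    let _ := A.weakStar
    refine h.congr fun x => ?_
    change inner ℂ _ (amp ℕ (Hom.toFun f x : B.space →L[ℂ] B.space) _) = _
    rw [amp_inclL, inner_inclL_left, inclL_self]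
  have hnhds : φ ⁻¹' Metric.ball 0 1 ∈ @nhds _ A.weakStar 0 := by
    let _ := A.weakStar
    refine hφ.continuousAt.preimage_mem_nhds ?_
    have : φ 0 = 0 := by
      change inner ℂ ξ ((Hom.toFun f 0 : B.space →L[ℂ] B.space) ξ) = 0
      rw [map_zero]
      exact inner_zero_right _
    rw [this]
    exact Metric.ball_mem_nhds _ one_pos
  rw [nhds_induced, nhds_pi, Filter.mem_comap] at hnhds
  obtain ⟨t, ht, hts⟩ := hnhds
  obtain ⟨I, hI, U, hU, hUt⟩ := Filter.mem_pi.1 ht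
  -- Only the finitely many coordinates in `I` are constrained, so one radius `δ` serves them all.
  have hδ : ∀ᶠ δ in nhdsWithin (0 : ℝ) (Set.Ioi 0), ∀ q ∈ I, Metric.ball 0 δ ⊆ U q := by
    rw [Filter.eventually_all_finite hI]
    intro q _
    have h0 : U q ∈ nhds (0 : ℂ) := by
      have := hU q
      convert this using 2
      simp
    obtain ⟨r, hr, hrU⟩ := Metric.mem_nhds_iff.1 h0
    filter_upwards [Ioo_mem_nhdsGT hr] with δ hδ
    exact (Metric.ball_subset_ball hδ.2.le).trans hrU
  obtain ⟨δ, hδI, hδ0⟩ := (hδ.and self_mem_nhdsWithin).exists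
  obtain ⟨ζ, hζ⟩ := exists_dominating (hI.toFinset.image Prod.fst ∪ hI.toFinset.image Prod.snd)
  -- If `‖x ζ‖ < √δ`, Cauchy–Schwarz bounds every coordinate of `star x * x` in `I` by `‖x ζ‖ ^ 2 <
  -- δ`, which gives `‖f x ξ‖ < 1`.
  refine ⟨ζ, (√δ)⁻¹, norm_le_of_norm_lt_imp _ _ (Real.sqrt_pos.2 hδ0) fun x hx => ?_⟩
  have hlt : ‖φ (star x * x)‖ < 1 := by
    rw [← mem_ball_zero_iff]
    refine hts (hUt fun q hq => hδI q hq ?_)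
    rw [mem_ball_zero_iff]
    change ‖inner ℂ q.1 (amp ℕ ((star (x : A.space →L[ℂ] A.space)) * (x : A.space →L[ℂ] A.space)) q.2)‖ < δ
    rw [amp_mul, ← inner_amp_left]
    refine (norm_inner_le_norm _ _).trans_lt ?_
    have h1 := hζ q.1 (by
      simp only [Finset.mem_union, Finset.mem_image, Set.Finite.mem_toFinset]
      exact Or.inl ⟨q, hq, rfl⟩) x
    have h2 := hζ q.2 (by
      simp only [Finset.mem_union, Finset.mem_image, Set.Finite.mem_toFinset]
      exact Or.inr ⟨q, hq, rfl⟩) x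
    have h3 : ‖amp _ (x : A.space →L[ℂ] A.space) ζ‖ < √δ := hx
    calc _ ≤ ‖amp _ (x : A.space →L[ℂ] A.space) ζ‖ * ‖amp _ (x : A.space →L[ℂ] A.space) ζ‖ := by
          gcongr
      _ < √δ * √δ := by gcongr
      _ = δ := Real.mul_self_sqrt hδ0.le
  have h2 : φ (star x * x) = (‖f.orbit ξ x‖ : ℂ) ^ 2 := f.norm_sq_apply x ξ
  rw [h2, norm_pow, Complex.norm_real, norm_norm] at hlt
  exact (sq_lt_one_iff₀ (norm_nonneg _)).1 hlt

/-- Every cyclic subrepresentation of a normal representation is equivalent to a cyclic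
subrepresentation of a multiple of the identity representation. -/
theorem Hom.exists_orbit_inner_eq (f : A ⟶ B) (ξ : B.space) :
    ∃ ζ : Ell2 (Ell2 ℕ A.space × ℕ) A.space,
      ∀ x y, inner ℂ (f.orbit ξ x) (f.orbit ξ y) = inner ℂ (ampOrbit ζ x) (ampOrbit ζ y) := by
  obtain ⟨ζ, C, hC⟩ := f.exists_orbit_le ξ
  obtain ⟨w, hw, hw0⟩ := exists_factor_of_norm_le _ _ C hC
  let J : Type _ := Ell2 ℕ A.space × ℕ
  change Ell2 J A.space →L[ℂ] B.space at w
  have hint : ∀ (y : A.Carrier) v, w (amp J (y : A.space →L[ℂ] A.space) v) =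
      (Hom.toFun f y : B.space →L[ℂ] B.space) (w v) := by
    intro y
    -- The intertwining relation for `y` holds on a closed subspace `E`; it remains to see that `E`
    -- contains the closed orbit of `ζ` and its orthogonal complement.
    let E : Submodule ℂ (Ell2 J A.space) := LinearMap.eqLocus
      (w ∘L amp J (y : A.space →L[ℂ] A.space)).toLinearMap
      ((Hom.toFun f y : B.space →L[ℂ] B.space) ∘L w).toLinearMap
    have hEc : IsClosed (E : Set (Ell2 J A.space)) :=
      isClosed_eq (w ∘L amp J (y : A.space →L[ℂ] A.space)).continuous
        ((Hom.toFun f y : B.space →L[ℂ] B.space) ∘L w).continuous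
    have h1 : (LinearMap.range (ampOrbit ζ)).topologicalClosure ≤ E := by
      refine Submodule.topologicalClosure_minimal _ ?_ hEc
      rintro _ ⟨x, rfl⟩
      change w (ampOrbit ζ (y * x)) = (Hom.toFun f y : B.space →L[ℂ] B.space) (w (ampOrbit ζ x))
      rw [hw, hw]
      exact f.apply_mul y x ξ
    -- Here `w` vanishes, and `y` preserves the complement because `star y` preserves the orbit.
    have h2 : (LinearMap.range (ampOrbit ζ)).topologicalClosureᗮ ≤ E := by
      intro v hv
      rw [Submodule.orthogonal_closure, Submodule.mem_orthogonal] at hv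
      change w (amp J (y : A.space →L[ℂ] A.space) v) =
        (Hom.toFun f y : B.space →L[ℂ] B.space) (w v)
      rw [hw0 v fun x => hv _ ⟨x, rfl⟩, map_zero]
      refine hw0 _ fun x => ?_
      rw [inner_amp_right]
      exact hv (ampOrbit ζ (star y * x)) ⟨_, rfl⟩
    have : CompleteSpace (LinearMap.range (ampOrbit ζ)).topologicalClosure :=
      (Submodule.isClosed_topologicalClosure _).completeSpace_coe
    intro v
    have hv : v ∈ E := by
      refine (sup_le h1 h2) ?_
      rw [Submodule.sup_orthogonal_of_hasOrthogonalProjection]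
      trivial
    exact hv
  -- The absolute value of `w` gives the same inner products as `w` but acts within the multiple of
  -- `A`, and it commutes with `A`. Thus `s ζ` has the orbit Gram matrix of `ξ`.
  obtain ⟨s, hs, hcomm⟩ := exists_sqrt_commute w
  have hscomm : ∀ (y : A.Carrier) v, s (amp J (y : A.space →L[ℂ] A.space) v) =
      amp J (y : A.space →L[ℂ] A.space) (s v) := fun y =>
    hcomm _ (amp J (star y : A.space →L[ℂ] A.space)) (fun u v => inner_amp_left _ u v)
      fun u v => by
        rw [hint, f.inner_apply_left, ← hint]
        rfl
  refine ⟨s ζ, fun x y => ?_⟩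
  have hsx : ∀ x, ampOrbit (s ζ) x = s (ampOrbit ζ x) := fun x => (hscomm x ζ).symm
  rw [hsx, hsx, hs, hw, hw]

/-- Structure of normal representations: up to equivalence, every normal unital representation of
`A` is a subrepresentation of a multiple of the identity representation. -/
theorem Hom.exists_implements (f : A ⟶ B) :
    ∃ (J : Type u) (V : B.space →ₗᵢ[ℂ] Ell2 J A.space), Implements V (Hom.toFun f) := by
  classical
  -- a maximal set of vectors generating orthogonal cyclic subspaces
  let P : Set (Set B.space) := {S | ∀ ξ ∈ S, ∀ η ∈ S, ξ ≠ η → ∀ x, inner ℂ ξ (f.orbit η x) = 0}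
  obtain ⟨S, hS⟩ : ∃ S, Maximal (fun S => S ∈ P) S := by
    refine zorn_subset P fun c hc hchain => ⟨⋃₀ c, ?_, fun s hs => Set.subset_sUnion_of_mem hs⟩
    rintro ξ ⟨s, hs, hξ⟩ η ⟨t, ht, hη⟩ hne x
    obtain h | h := hchain.total hs ht
    · exact hc ht ξ (h hξ) η hη hne x
    · exact hc hs ξ hξ η (h hη) hne x
  have horth : ∀ ξ ∈ S, ∀ η ∈ S, ξ ≠ η → ∀ x y, inner ℂ (f.orbit ξ x) (f.orbit η y) = 0 := by
    intro ξ hξ η hη hne x y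
    have := hS.prop ξ hξ η hη hne (star x * y)
    change inner ℂ ξ ((Hom.toFun f (star x * y) : B.space →L[ℂ] B.space) η) = 0 at this
    rw [f.apply_mul, ← f.inner_apply_left] at this
    exact this
  have hdense : (Submodule.span ℂ (Set.range fun p : S × A.Carrier =>
      f.orbit p.1 p.2)).topologicalClosure = ⊤ := by
    rw [Submodule.topologicalClosure_eq_top_iff, Submodule.eq_bot_iff]
    intro η hη
    rw [Submodule.mem_orthogonal] at hη
    have h0 : ∀ ξ ∈ S, ∀ x, inner ℂ (f.orbit ξ x) η = 0 := fun ξ hξ x =>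
      hη _ (Submodule.subset_span ⟨(⟨ξ, hξ⟩, x), rfl⟩)
    have h1 : ∀ ξ, f.orbit ξ 1 = ξ := fun ξ => by
      change (Hom.toFun f 1 : B.space →L[ℂ] B.space) ξ = ξ
      rw [map_one]
      rfl
    -- A vector orthogonal to all the orbits could be added to `S`; by maximality it already lies in
    -- `S`, hence is orthogonal to itself.
    have hmem : insert η S ∈ P := by
      have hη' : ∀ ξ ∈ S, ∀ x, inner ℂ ξ (f.orbit η x) = 0 := fun ξ hξ x => by
        have := h0 ξ hξ (star x)
        change inner ℂ ((Hom.toFun f (star x) : B.space →L[ℂ] B.space) ξ) η = 0 at this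
        rw [f.inner_apply_left, star_star] at this
        exact this
      have hη'' : ∀ ξ ∈ S, ∀ x, inner ℂ η (f.orbit ξ x) = 0 := fun ξ hξ x =>
        inner_eq_zero_symm.1 (h0 ξ hξ x)
      rintro ξ (rfl | hξ) ζ (rfl | hζ) hne x
      · exact (hne rfl).elim
      · exact hη'' ζ hζ x
      · exact hη' ξ hξ x
      · exact hS.prop ξ hξ ζ hζ hne x
    have hηS : η ∈ S := hS.le_of_ge hmem (Set.subset_insert _ _) (Set.mem_insert _ _)
    have := h0 η hηS 1
    rw [h1] at this
    exact inner_self_eq_zero.1 this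
  choose ζ hζ using f.exists_orbit_inner_eq
  let Q : Type u := Ell2 ℕ A.space × ℕ
  let e : S → Q ↪ S × Q := fun ξ => ⟨fun q => (ξ, q), fun p q h => (Prod.ext_iff.1 h).2⟩
  obtain ⟨V, hV⟩ := exists_linearIsometry_of_gram
    (fun p : S × A.Carrier => f.orbit p.1 p.2)
    (fun p : S × A.Carrier => (extendVec (e p.1) (ampOrbit (ζ p.1) p.2) : Ell2 (S × Q) A.space))
    hdense (by
      rintro ⟨ξ, x⟩ ⟨η, y⟩
      by_cases h : ξ = η
      · subst h
        rw [inner_extendVec_extendVec, hζ]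
      · rw [horth ξ ξ.2 η η.2 (fun h' => h (Subtype.ext h')), inner_extendVec]
        refine ((tsum_congr fun q => ?_).trans tsum_zero).symm
        rw [extendVec_of_notMem, inner_zero_right]
        rintro ⟨q', hq'⟩
        exact h (Prod.ext_iff.1 hq').1.symm)
  refine ⟨S × Q, V, fun x v => ?_⟩
  suffices V.toContinuousLinearMap ∘L (Hom.toFun f x : B.space →L[ℂ] B.space) =
      amp (S × Q) (x : A.space →L[ℂ] A.space) ∘L V.toContinuousLinearMap from
    congrArg (fun g => g v) this
  refine ContinuousLinearMap.ext_on (Submodule.dense_iff_topologicalClosure_eq_top.2 hdense) ?_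
  rintro _ ⟨p, rfl⟩
  change V ((Hom.toFun f x : B.space →L[ℂ] B.space) (f.orbit p.1 p.2)) =
    amp (S × Q) (x : A.space →L[ℂ] A.space) (V (f.orbit p.1 p.2))
  rw [hV, amp_extendVec]
  have : (Hom.toFun f x : B.space →L[ℂ] B.space) (f.orbit p.1 p.2) = f.orbit p.1 (x * p.2) :=
    (f.apply_mul _ _ _).symm
  rw [this]
  exact hV (p.1, x * p.2)

/-- A morphism is determined by its values on a generating set. -/
theorem hom_ext_of_isGenerating {S : Set (A.space →L[ℂ] A.space)} (hS : IsGenerating S A.alg)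
    {f g : A ⟶ B} (h : ∀ s (hs : s ∈ S),
      Hom.toFun f ⟨s, hS.subset s hs⟩ = Hom.toFun g ⟨s, hS.subset s hs⟩) : f = g := by
  obtain ⟨I, V, hV⟩ := f.exists_implements
  obtain ⟨J, W, hW⟩ := g.exists_implements
  let Wa := ContinuousLinearMap.adjoint W.toContinuousLinearMap
  have hWW : ∀ v, Wa (W v) = v := fun v => by
    refine ext_inner_left ℂ fun u => ?_
    rw [ContinuousLinearMap.adjoint_inner_right]
    exact W.inner_map_map u v
  have hWa : ∀ (x : A.Carrier) v, Wa (amp J (x : A.space →L[ℂ] A.space) v) =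
      (Hom.toFun g x : B.space →L[ℂ] B.space) (Wa v) := by
    intro x v
    refine ext_inner_left ℂ fun u => ?_
    rw [ContinuousLinearMap.adjoint_inner_right, inner_amp_right]
    have h1 := g.inner_apply_left (star x) u (Wa v)
    rw [star_star] at h1
    rw [← h1, ContinuousLinearMap.adjoint_inner_right]
    exact congrArg (fun z => inner ℂ z v) (hW (star x) u).symm
  refine Hom.ext (StarAlgHom.ext fun x => Subtype.ext (ContinuousLinearMap.ext fun v =>
    V.injective ?_))
  -- `V Wa` intertwines the two multiples on generators because `f` and `g` agree there, hence on
  -- all of `A`. Applied to `W v`, this reads `V (g x v) = V (f x v)`.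
  have := hS.comm_amp (V.toContinuousLinearMap ∘L Wa) (fun s hs v => by
    change V (Wa (amp J s v)) = amp I s (V (Wa v))
    rw [hWa ⟨s, hS.subset s hs⟩ v, ← h s hs, hV]) x.2 (W v)
  change V (Wa (amp J _ (W v))) = amp I _ (V (Wa (W v))) at this
  rw [hWa, hWW] at this
  rw [hV, this]

end WStar

end FreeExp

end
-- Tensor products of Hilbert spaces and of morphisms.
noncomputable section

namespace FreeExp

section HilbertTensor

variable {H : Type*} [NormedAddCommGroup H] [InnerProductSpace ℂ H]
  {K : Type*} [NormedAddCommGroup K] [InnerProductSpace ℂ K]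
  {H' : Type*} [NormedAddCommGroup H'] [InnerProductSpace ℂ H']
  {K' : Type*} [NormedAddCommGroup K'] [InnerProductSpace ℂ K']
  {L : Type*} [NormedAddCommGroup L] [InnerProductSpace ℂ L]

/-- The elementary tensor `x ⊗ y` in the Hilbert space tensor product. -/
def htmul (x : H) (y : K) : HilbertTensor H K := ((x ⊗ₜ[ℂ] y : H ⊗[ℂ] K) : HilbertTensor H K)

theorem inner_htmul (x x' : H) (y y' : K) :
    inner ℂ (htmul x y) (htmul x' y') = inner ℂ x x' * inner ℂ y y' := by
  rw [htmul, htmul, UniformSpace.Completion.inner_coe, TensorProduct.inner_tmul]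

theorem norm_htmul (x : H) (y : K) : ‖htmul x y‖ = ‖x‖ * ‖y‖ := by
  rw [htmul, UniformSpace.Completion.norm_coe, TensorProduct.norm_tmul]

theorem tensorOp_htmul (a : H →L[ℂ] H) (b : K →L[ℂ] K) (x : H) (y : K) :
    tensorOp a b (htmul x y) = htmul (a x) (b y) :=
  tensorOp_tmul a b x y

variable (H K) in
theorem dense_span_htmul :
    (Submodule.span ℂ (Set.range fun p : H × K => htmul p.1 p.2)).topologicalClosure = ⊤ := by
  rw [← Submodule.dense_iff_topologicalClosure_eq_top]
  refine (UniformSpace.Completion.denseRange_coe (α := H ⊗[ℂ] K)).mono ?_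
  rintro _ ⟨t, rfl⟩
  induction t with
  | zero =>
    rw [UniformSpace.Completion.coe_zero]
    exact Submodule.zero_mem _
  | tmul x y => exact Submodule.subset_span ⟨(x, y), rfl⟩
  | add s t hs ht =>
    rw [UniformSpace.Completion.coe_add]
    exact Submodule.add_mem _ hs ht

theorem ext_htmul {f g : HilbertTensor H K →L[ℂ] L}
    (h : ∀ x y, f (htmul x y) = g (htmul x y)) : f = g := by
  refine ContinuousLinearMap.ext_on
    (Submodule.dense_iff_topologicalClosure_eq_top.2 (dense_span_htmul H K)) ?_
  rintro _ ⟨p, rfl⟩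
  exact h p.1 p.2

theorem star_tensorOp [CompleteSpace H] [CompleteSpace K] (a : H →L[ℂ] H) (b : K →L[ℂ] K) :
    star (tensorOp a b) = tensorOp (star a) (star b) := by
  refine ext_htmul fun x y => ?_
  rw [tensorOp_htmul]
  have h : ∀ v : HilbertTensor H K, inner ℂ (star (tensorOp a b) (htmul x y)) v =
      inner ℂ (htmul (star a x) (star b y)) v := by
    have := ext_htmul (f := innerSL ℂ (star (tensorOp a b) (htmul x y)))
      (g := innerSL ℂ (htmul (star a x) (star b y))) fun x' y' => by
        change inner ℂ (star (tensorOp a b) (htmul x y)) (htmul x' y') =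
          inner ℂ (htmul (star a x) (star b y)) (htmul x' y')
        simp only [ContinuousLinearMap.star_eq_adjoint, ContinuousLinearMap.adjoint_inner_left,
          tensorOp_htmul, inner_htmul]
    exact fun v => congrArg (fun f => f v) this
  exact ext_inner_right ℂ h

theorem memℓp_htmul {I J : Type*} (v : Ell2 I H) (w : Ell2 J K) :
    Memℓp (fun p : I × J => htmul (v p.1) (w p.2)) 2 := by
  refine memℓp_two_iff.2 ?_
  simp_rw [norm_htmul, mul_pow]
  exact (memℓp_two_iff.1 (lp.memℓp v)).mul_of_nonneg (memℓp_two_iff.1 (lp.memℓp w))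
    (fun _ => by positivity) (fun _ => by positivity)

/-- The family of tensor products of the members of two square-summable families. -/
def ellTensor {I J : Type*} (v : Ell2 I H) (w : Ell2 J K) : Ell2 (I × J) (HilbertTensor H K) :=
  ⟨_, memℓp_htmul v w⟩

theorem inner_ellTensor {I J : Type*} (v v' : Ell2 I H) (w w' : Ell2 J K) :
    inner ℂ (ellTensor v w) (ellTensor v' w') = inner ℂ v v' * inner ℂ w w' := by
  have hv := (lp.summable_inner (𝕜 := ℂ) v v').norm
  have hw := (lp.summable_inner (𝕜 := ℂ) w w').norm
  have h := tsum_mul_tsum_of_summable_norm (f := fun i => inner ℂ (v i) (v' i))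
    (g := fun j => inner ℂ (w j) (w' j)) hv hw
  refine Eq.trans ?_ h.symm
  exact tsum_congr fun p => inner_htmul (v p.1) (v' p.1) (w p.2) (w' p.2)

theorem exists_isometry_tensor {I J : Type*} (V : H →ₗᵢ[ℂ] Ell2 I H') (W : K →ₗᵢ[ℂ] Ell2 J K') :
    ∃ U : HilbertTensor H K →ₗᵢ[ℂ] Ell2 (I × J) (HilbertTensor H' K'),
      ∀ x y, U (htmul x y) = ellTensor (V x) (W y) := by
  obtain ⟨U, hU⟩ := exists_linearIsometry_of_gram (fun p : H × K => htmul p.1 p.2)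
    (fun p : H × K => ellTensor (V p.1) (W p.2)) (dense_span_htmul H K) (by
      rintro ⟨x, y⟩ ⟨x', y'⟩
      rw [inner_htmul, inner_ellTensor, V.inner_map_map, W.inner_map_map])
  exact ⟨U, fun x y => hU (x, y)⟩

end HilbertTensor

namespace WStar

theorem isGenerating_tensor (M N : WStar.{u}) :
    IsGenerating {T | ∃ (m : M.Carrier) (n : N.Carrier),
      T = tensorOp (m : M.space →L[ℂ] M.space) (n : N.space →L[ℂ] N.space)} (tensor M N).alg := by
  refine isGenerating_vnGenerated ?_
  rintro _ ⟨m, n, rfl⟩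
  exact ⟨star m, star n, star_tensorOp _ _⟩

theorem tensor_hom_ext {M N R : WStar.{u}} {f g : tensor M N ⟶ R}
    (h : ∀ m n, Hom.toFun f (tmul m n) = Hom.toFun g (tmul m n)) : f = g := by
  refine hom_ext_of_isGenerating (isGenerating_tensor M N) ?_
  rintro _ ⟨m, n, rfl⟩
  exact h m n

/-- The tensor product of isometries implementing `π` and `ρ` implements `π ⊗ ρ` on elementary
operators, which generate; `exists_hom_of_isometry` does the rest, including normality. -/
theorem exists_isTensorHom {M₀ M₁ N₀ N₁ : WStar.{u}} (π : M₀ ⟶ M₁) (ρ : N₀ ⟶ N₁) :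
    ∃ τ : tensor M₀ N₀ ⟶ tensor M₁ N₁, IsTensorHom π ρ τ := by
  obtain ⟨I, V, hV⟩ := Hom.exists_implements π
  obtain ⟨J, W, hW⟩ := Hom.exists_implements ρ
  obtain ⟨U, hU⟩ := exists_isometry_tensor V W
  have key : ∀ (m : M₀.Carrier) (n : N₀.Carrier) (v : (tensor M₁ N₁).space),
      U (tensorOp (Hom.toFun π m : M₁.space →L[ℂ] M₁.space)
          (Hom.toFun ρ n : N₁.space →L[ℂ] N₁.space) v) =
        amp (I × J) (tensorOp (m : M₀.space →L[ℂ] M₀.space) (n : N₀.space →L[ℂ] N₀.space)) (U v) := by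
    intro m n
    suffices U.toContinuousLinearMap ∘L tensorOp (Hom.toFun π m : M₁.space →L[ℂ] M₁.space)
        (Hom.toFun ρ n : N₁.space →L[ℂ] N₁.space) =
        amp (I × J) (tensorOp (m : M₀.space →L[ℂ] M₀.space) (n : N₀.space →L[ℂ] N₀.space)) ∘L
          U.toContinuousLinearMap from fun v => congrArg (fun f => f v) this
    refine ext_htmul fun x y => ?_
    change U (tensorOp _ _ (htmul x y)) = amp _ _ (U (htmul x y))
    rw [tensorOp_htmul, hU, hU]
    ext p
    change htmul (V _ p.1) (W _ p.2) = tensorOp _ _ (htmul (V x p.1) (W y p.2))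
    rw [tensorOp_htmul, hV, hW]
    rfl
  obtain ⟨τ, hτ⟩ := exists_hom_of_isometry (A := tensor M₀ N₀) (B := tensor M₁ N₁) U
    (isGenerating_tensor M₀ N₀) (by
      rintro _ ⟨m, n, rfl⟩
      exact ⟨tmul (Hom.toFun π m) (Hom.toFun ρ n), key m n⟩)
  refine ⟨τ, fun m n => Subtype.ext (ContinuousLinearMap.ext fun v => U.injective ?_)⟩
  exact (hτ (tmul m n) v).trans (key m n v).symm

/-- The tensor product of two morphisms. -/
def tensorHom {M₀ M₁ N₀ N₁ : WStar.{u}} (π : M₀ ⟶ M₁) (ρ : N₀ ⟶ N₁) :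
    tensor M₀ N₀ ⟶ tensor M₁ N₁ :=
  (exists_isTensorHom π ρ).choose

section

variable {M₀ M₁ M₂ N₀ N₁ N₂ : WStar.{u}}

theorem tensorHom_tmul (π : M₀ ⟶ M₁) (ρ : N₀ ⟶ N₁) (m : M₀.Carrier) (n : N₀.Carrier) :
    Hom.toFun (tensorHom π ρ) (tmul m n) = tmul (Hom.toFun π m) (Hom.toFun ρ n) :=
  (exists_isTensorHom π ρ).choose_spec m n

theorem isTensorHom_iff {π : M₀ ⟶ M₁} {ρ : N₀ ⟶ N₁} {τ : tensor M₀ N₀ ⟶ tensor M₁ N₁} :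
    IsTensorHom π ρ τ ↔ τ = tensorHom π ρ := by
  refine ⟨fun h => tensor_hom_ext fun m n => ?_, ?_⟩
  · rw [h m n, tensorHom_tmul]
  · rintro rfl
    exact tensorHom_tmul π ρ

theorem comp_apply {A B C : WStar.{u}} (f : A ⟶ B) (g : B ⟶ C) (x : A.Carrier) :
    Hom.toFun (f ≫ g) x = Hom.toFun g (Hom.toFun f x) := rfl

theorem tensorHom_comp (π : M₀ ⟶ M₁) (ρ : N₀ ⟶ N₁) (π' : M₁ ⟶ M₂) (ρ' : N₁ ⟶ N₂) :
    tensorHom (π ≫ π') (ρ ≫ ρ') = tensorHom π ρ ≫ tensorHom π' ρ' :=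
  tensor_hom_ext fun m n => by
    rw [comp_apply, tensorHom_tmul, tensorHom_tmul, tensorHom_tmul]
    rfl

theorem tensorHom_id (M N : WStar.{u}) : tensorHom (𝟙 M) (𝟙 N) = 𝟙 (tensor M N) :=
  tensor_hom_ext fun m n => tensorHom_tmul _ _ m n

end

end WStar

end FreeExp

end
-- Direct sums as products, and their recognition.
noncomputable section

namespace FreeExp

section DirectSum

variable {I : Type*} {K : I → Type*} [∀ i, NormedAddCommGroup (K i)]
  [∀ i, InnerProductSpace ℂ (K i)]

theorem norm_amp_apply_le {J : Type*} {H : Type*} [NormedAddCommGroup H] [InnerProductSpace ℂ H]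
    (T : H →L[ℂ] H) (v : Ell2 J H) : ‖amp J T v‖ ≤ ‖T‖ * ‖v‖ :=
  (amp J T).le_of_opNorm_le (LinearMap.mkContinuous_norm_le _ (norm_nonneg _) _) v

/-- The diagonal operator with a uniformly bounded family of entries. -/
def diagOp (T : ∀ i, K i →L[ℂ] K i) (C : ℝ) (hT : ∀ i v, ‖T i v‖ ≤ C * ‖v‖) :
    lp K 2 →L[ℂ] lp K 2 :=
  -- The operator bound is `|C|`: the hypothesis permits a negative `C` when all the spaces are
  -- trivial.
  LinearMap.mkContinuous
    { toFun := fun v => ⟨fun i => T i (v i),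
        Memℓp.mono' ((lp.memℓp v).const_smul (C : ℂ)) fun i => (hT i (v i)).trans (by
          rw [Pi.smul_apply, norm_smul, Complex.norm_real, Real.norm_eq_abs]
          gcongr
          exact le_abs_self C)⟩
      map_add' := fun v w => by ext i; exact map_add (T i) _ _
      map_smul' := fun c v => by ext i; exact map_smul (T i) _ _ } |C| fun v => by
    have : ‖((C : ℂ) • v : lp K 2)‖ = |C| * ‖v‖ := by
      rw [norm_smul, Complex.norm_real, Real.norm_eq_abs]
    rw [← this]
    refine lp.norm_mono (by norm_num) fun i => (hT i (v i)).trans ?_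
    rw [lp.coeFn_smul, Pi.smul_apply, norm_smul, Complex.norm_real, Real.norm_eq_abs]
    gcongr
    exact le_abs_self C

variable {H : Type*} [NormedAddCommGroup H] [InnerProductSpace ℂ H] {J : I → Type*}

/-- The direct sum of isometries into multiples of `H`. -/
def sigmaIsometry (U : ∀ i, K i →ₗᵢ[ℂ] Ell2 (J i) H) :
    lp K 2 →ₗᵢ[ℂ] Ell2 (Σ i, J i) H := by
  have hsum : ∀ v : lp K 2, Summable fun p : Σ i, J i => ‖U p.1 (v p.1) p.2‖ ^ 2 := fun v => by
    refine (summable_sigma_of_nonneg fun p => by positivity).2 ⟨fun i => ?_, ?_⟩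
    · exact memℓp_two_iff.1 (lp.memℓp (U i (v i)))
    · refine (memℓp_two_iff.1 (lp.memℓp v)).congr fun i => ?_
      rw [← (U i).norm_map]
      exact norm_sq_eq_tsum _
  refine ⟨{ toFun := fun v => ⟨fun p => U p.1 (v p.1) p.2, memℓp_two_iff.2 (hsum v)⟩
            map_add' := fun v w => ?_
            map_smul' := fun c v => ?_ }, fun v => ?_⟩
  · ext p
    change U p.1 (v p.1 + w p.1) p.2 = _
    rw [(U p.1).map_add]
    rfl
  · ext p
    change U p.1 (c • v p.1) p.2 = _
    rw [(U p.1).map_smul]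
    rfl
  · rw [← sq_eq_sq₀ (norm_nonneg _) (norm_nonneg _), norm_sq_eq_tsum, norm_sq_eq_tsum]
    refine (hsum v).tsum_sigma.trans (tsum_congr fun i => ?_)
    rw [← (U i).norm_map]
    exact (norm_sq_eq_tsum (U i (v i))).symm

variable [∀ i, CompleteSpace (K i)]

theorem star_inclL_comp_coordL (i : I) (s : K i →L[ℂ] K i) :
    star (inclL K i ∘L s ∘L coordL K i) = inclL K i ∘L star s ∘L coordL K i := by
  refine ContinuousLinearMap.ext fun v => ext_inner_left ℂ fun u => ?_
  rw [ContinuousLinearMap.star_eq_adjoint, ContinuousLinearMap.adjoint_inner_right]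
  change inner ℂ (inclL K i (s (u i))) v = inner ℂ u (inclL K i (star s (v i)))
  rw [inner_inclL_left, inner_inclL_right, ContinuousLinearMap.star_eq_adjoint,
    ContinuousLinearMap.adjoint_inner_right]

theorem isDiagonal_inclL_comp_coordL {N : ∀ i, VonNeumannAlgebra (K i)} (i : I)
    {s : K i →L[ℂ] K i} (hs : s ∈ (N i).toStarSubalgebra) :
    IsDiagonal N (inclL K i ∘L s ∘L coordL K i) := by
  intro j
  by_cases h : j = i
  · subst h
    exact ⟨s, hs, fun v => inclL_self j _⟩
  · exact ⟨0, zero_mem (N j).toStarSubalgebra, fun v => inclL_ne h _⟩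

/-- Because `1 ∈ S i`, the coordinate projections belong to the set. An operator commuting with it
is therefore block diagonal, and the claim reduces to the blocks. -/
theorem isGenerating_directSumAlg {N : ∀ i, VonNeumannAlgebra (K i)}
    {S : ∀ i, Set (K i →L[ℂ] K i)} (hS : ∀ i, IsGenerating (S i) (N i)) (h1 : ∀ i, 1 ∈ S i) :
    IsGenerating {T | ∃ i, ∃ s ∈ S i, T = inclL K i ∘L s ∘L coordL K i} (directSumAlg N) := by
  refine ⟨?_, ?_, fun c hc T hT => ?_⟩
  · rintro _ ⟨i, s, hs, rfl⟩
    exact isDiagonal_inclL_comp_coordL i ((hS i).subset s hs)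
  · rintro _ ⟨i, s, hs, rfl⟩
    exact ⟨i, star s, (hS i).star_mem s hs, star_inclL_comp_coordL i s⟩
  · have hcomm : ∀ i, ∀ s ∈ S i, ∀ v : lp K 2,
        c (inclL K i (s (v i))) = inclL K i (s (c v i)) := fun i s hs v =>
      congrArg (fun f : lp K 2 →L[ℂ] lp K 2 => f v) (hc _ ⟨i, s, hs, rfl⟩)
    have hdiag : ∀ i x, c (inclL K i x) = inclL K i (c (inclL K i x) i) := fun i x => by
      have := hcomm i 1 (h1 i) (inclL K i x)
      rw [inclL_self] at this
      exact this
    refine ext_inclL fun i x => ?_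
    obtain ⟨m, hm, hTm⟩ := hT i
    have hTi : ∀ y, T (inclL K i y) = inclL K i (m y) := fun y => by
      ext j
      by_cases h : j = i
      · subst h
        rw [hTm, inclL_self, inclL_self]
      · obtain ⟨m', -, hm'⟩ := hT j
        rw [hm', inclL_ne h, inclL_ne h, map_zero]
    change c (T (inclL K i x)) = T (c (inclL K i x))
    have hcm := (hS i).comm (coordL K i ∘L c ∘L inclL K i) (fun s hs => by
      ext y
      change c (inclL K i (s y)) i = s (c (inclL K i y) i)
      have := hcomm i s hs (inclL K i y)
      rw [inclL_self] at this
      rw [this, inclL_self]) m hm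
    have hcx : c (inclL K i (m x)) i = m (c (inclL K i x) i) :=
      congrArg (fun f : K i →L[ℂ] K i => f x) hcm
    rw [hTi, hdiag i (m x), hcx, hdiag i x, hTi, inclL_self]

end DirectSum

section Unitary

variable {H : Type*} [NormedAddCommGroup H] [InnerProductSpace ℂ H]
  {I : Type*} {K : I → Type*} [∀ i, NormedAddCommGroup (K i)] [∀ i, InnerProductSpace ℂ (K i)]
  {L : I → Type*} [∀ i, NormedAddCommGroup (L i)] [∀ i, InnerProductSpace ℂ (L i)]
  [∀ i, CompleteSpace (L i)]

/-- The Hilbert space tensor product distributes over `ℓ²`-direct sums. Here `β i` is a model of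
the tensor product of `H` and `K i`. -/
theorem exists_unitary_tensor_lp (β : ∀ i, H → K i → L i)
    (hβ : ∀ i x x' y y', inner ℂ (β i x y) (β i x' y') = inner ℂ x x' * inner ℂ y y')
    (hd : ∀ i, (Submodule.span ℂ (Set.range fun p : H × K i => β i p.1 p.2)).topologicalClosure = ⊤) :
    ∃ U : HilbertTensor H (lp K 2) ≃ₗᵢ[ℂ] lp L 2, ∀ x y i, U (htmul x y) i = β i x (y i) := by
  have hnorm : ∀ i x y, ‖β i x y‖ = ‖x‖ * ‖y‖ := fun i x y => by
    have h := hβ i x x y y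
    simp only [inner_self_eq_norm_sq_to_K] at h
    rw [← sq_eq_sq₀ (norm_nonneg _) (by positivity), mul_pow]
    exact_mod_cast h
  have hmem : ∀ x (y : lp K 2), Memℓp (fun i => β i x (y i)) 2 := fun x y => by
    refine memℓp_two_iff.2 ?_
    simp_rw [hnorm, mul_pow]
    exact (memℓp_two_iff.1 (lp.memℓp y)).mul_left _
  obtain ⟨V, hV⟩ := exists_linearIsometry_of_gram (fun p : H × lp K 2 => htmul p.1 p.2)
    (fun p : H × lp K 2 => (⟨_, hmem p.1 p.2⟩ : lp L 2)) (dense_span_htmul H (lp K 2)) (by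
      rintro ⟨x, y⟩ ⟨x', y'⟩
      rw [inner_htmul, lp.inner_eq_tsum, lp.inner_eq_tsum, ← tsum_mul_left]
      exact tsum_congr fun i => (hβ i x x' (y i) (y' i)).symm)
  -- The range is complete, and a vector orthogonal to it has each coordinate orthogonal to the
  -- total set of the `β i x y`.
  have hsurj : Function.Surjective V := by
    have : CompleteSpace (LinearMap.range V.toLinearMap) :=
      V.isometry.isUniformInducing.isComplete_range.completeSpace_coe
    rw [← LinearIsometry.coe_toLinearMap, ← LinearMap.range_eq_top,
      ← Submodule.orthogonal_eq_bot_iff, Submodule.eq_bot_iff]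
    intro v hv
    ext i
    have hvi : v i ∈ (Submodule.span ℂ (Set.range fun p : H × K i => β i p.1 p.2))ᗮ := by
      rw [Submodule.mem_orthogonal]
      intro z hz
      induction hz using Submodule.span_induction with
      | mem z hz =>
        obtain ⟨p, rfl⟩ := hz
        have h : V (htmul p.1 (inclL K i p.2)) = inclL L i (β i p.1 p.2) := by
          ext j
          rw [hV (p.1, inclL K i p.2)]
          change β j p.1 (inclL K i p.2 j) = _
          by_cases h : j = i
          · subst h
            rw [inclL_self, inclL_self]
          · rw [inclL_ne h, inclL_ne h, ← norm_eq_zero, hnorm, norm_zero, mul_zero]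
        have h2 := (Submodule.mem_orthogonal _ _).1 hv _ ⟨htmul p.1 (inclL K i p.2), rfl⟩
        change inner ℂ (V _) v = 0 at h2
        rwa [h, inner_inclL_left] at h2
      | zero => exact inner_zero_left _
      | add x y _ _ hx hy => rw [inner_add_left, hx, hy, add_zero]
      | smul c x _ hx => rw [inner_smul_left, hx, mul_zero]
    rw [← Submodule.orthogonal_closure, hd, Submodule.top_orthogonal_eq_bot] at hvi
    exact (Submodule.mem_bot ℂ).1 hvi
  refine ⟨LinearIsometryEquiv.ofSurjective V hsurj, fun x y i => ?_⟩
  exact congrArg (fun z : lp L 2 => z i) (hV (x, y))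

end Unitary

namespace WStar

variable {I : Type u} {N : I → WStar.{u}}

theorem directSum_hom_ext {M : WStar.{u}} {f g : M ⟶ directSum N}
    (h : ∀ i, f ≫ proj N i = g ≫ proj N i) : f = g := by
  refine Hom.ext (StarAlgHom.ext fun x => Subtype.ext (ContinuousLinearMap.ext fun v => ?_))
  refine lp.ext (funext fun i => ?_)
  exact ((IsDiagonal.apply_eq (Hom.toFun f x).2 i v).trans (congrArg
    (fun k : M ⟶ N i => (Hom.toFun k x : (N i).space →L[ℂ] (N i).space) (coordL _ i v)) (h i))).trans
    (IsDiagonal.apply_eq (Hom.toFun g x).2 i v).symm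

/-- The direct sum is the product in the category of `W*`-algebras. -/
theorem exists_directSum_lift {M : WStar.{u}} (π : ∀ i, M ⟶ N i) :
    ∃ f : M ⟶ directSum N, ∀ i, f ≫ proj N i = π i := by
  choose J U hU using fun i => Hom.exists_implements (π i)
  -- The implementing isometries give `‖π i x v‖ ≤ ‖x‖ ‖v‖`, uniformly in `i`, so the diagonal
  -- operator is bounded.
  let D : M.Carrier → (lp (fun i => (N i).space) 2 →L[ℂ] lp (fun i => (N i).space) 2) := fun x =>
    diagOp (fun i => (Hom.toFun (π i) x : (N i).space →L[ℂ] (N i).space))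
      ‖(x : M.space →L[ℂ] M.space)‖ fun i v => by
        rw [← (U i).norm_map, ← (U i).norm_map v, hU]
        exact norm_amp_apply_le _ _
  have hD : ∀ x, D x ∈ (directSumAlg fun i => (N i).alg).toStarSubalgebra := fun x i =>
    ⟨_, (Hom.toFun (π i) x).2, fun v => rfl⟩
  have hVD : ∀ x v, sigmaIsometry U (D x v) =
      amp _ (x : M.space →L[ℂ] M.space) (sigmaIsometry U v) := by
    intro x v
    refine lp.ext (funext fun p => ?_)
    exact congrArg (fun z : Ell2 (J p.1) M.space => z p.2) (hU p.1 x (v p.1))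
  obtain ⟨f, hf⟩ := exists_hom_of_isometry (A := M) (B := directSum N) (sigmaIsometry U)
    (IsGenerating.self M.alg) fun x hx => ⟨⟨D ⟨x, hx⟩, hD ⟨x, hx⟩⟩, hVD ⟨x, hx⟩⟩
  have hfD : ∀ x, (Hom.toFun f x : (directSum N).space →L[ℂ] (directSum N).space) = D x := fun x =>
    ContinuousLinearMap.ext fun v => (sigmaIsometry U).injective ((hf x v).trans (hVD x v).symm)
  refine ⟨f, fun i => Hom.ext (StarAlgHom.ext fun x => Subtype.ext (ContinuousLinearMap.ext
    fun v => ?_))⟩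
  change coordL (fun i => (N i).space) i
    ((Hom.toFun f x : (directSum N).space →L[ℂ] (directSum N).space)
      (inclL (fun i => (N i).space) i v)) = _
  rw [hfD]
  change (Hom.toFun (π i) x : (N i).space →L[ℂ] (N i).space)
    (inclL (fun i => (N i).space) i v i) = _
  rw [inclL_self]

/-- Spatial implementation of a morphism by a single isometry. -/
theorem exists_hom_of_isometry_single {A B : WStar.{u}} (U : B.space →ₗᵢ[ℂ] A.space)
    {S : Set (A.space →L[ℂ] A.space)} (hS : IsGenerating S A.alg)
    (h : ∀ s ∈ S, ∃ b : B.Carrier, ∀ v, U ((b : B.space →L[ℂ] B.space) v) = s (U v)) :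
    ∃ f : A ⟶ B, ∀ (x : A.Carrier) v, U ((Hom.toFun f x : B.space →L[ℂ] B.space) v) =
      (x : A.space →L[ℂ] A.space) (U v) := by
  let E : A.space →ₗᵢ[ℂ] Ell2 Unit A.space :=
    LinearMap.isometryOfInner (inclL (fun _ : Unit => A.space) ()).toLinearMap fun x y => by
      change inner ℂ (inclL (fun _ : Unit => A.space) () x) (inclL (fun _ => A.space) () y) = _
      rw [inner_inclL_left, inclL_self]
  have hE : ∀ (T : A.space →L[ℂ] A.space) v, amp Unit T (E v) = E (T v) := fun T v =>
    amp_inclL T () v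
  obtain ⟨f, hf⟩ := exists_hom_of_isometry (E.comp U) hS fun s hs => by
    obtain ⟨b, hb⟩ := h s hs
    refine ⟨b, fun v => ?_⟩
    change E (U _) = amp Unit s (E (U v))
    rw [hb, hE]
  refine ⟨f, fun x v => E.injective ?_⟩
  rw [← hE]
  exact hf x v

/-- A `W*`-algebra whose space is an `ℓ²`-direct sum, and which contains and is contained in the
diagonal operators, is a direct sum. -/
theorem exists_iso_directSum {A : WStar.{u}}
    (U : A.space ≃ₗᵢ[ℂ] lp (fun i => (N i).space) 2)
    {S : Set (A.space →L[ℂ] A.space)} (hS : IsGenerating S A.alg)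
    {S' : ∀ i, Set ((N i).space →L[ℂ] (N i).space)} (hS' : ∀ i, IsGenerating (S' i) (N i).alg)
    (h1 : ∀ i, 1 ∈ S' i)
    (h : ∀ s ∈ S, ∀ i, ∃ b : (N i).Carrier, ∀ v,
      U (s v) i = (b : (N i).space →L[ℂ] (N i).space) (U v i))
    (h' : ∀ i, ∀ s ∈ S' i, ∃ a : A.Carrier, ∀ v,
      U ((a : A.space →L[ℂ] A.space) v) = inclL (fun i => (N i).space) i (s (U v i))) :
    ∃ e : A ≅ directSum N, ∀ (x : A.Carrier) (v : A.space) i,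
      (Hom.toFun (e.hom ≫ proj N i) x : (N i).space →L[ℂ] (N i).space) (U v i) =
        U ((x : A.space →L[ℂ] A.space) v) i := by
  -- Both `f` and `g` are conjugation by `U`, in opposite directions, so they are mutually inverse
  -- once they land in the right algebras; that is checked on generators only.
  obtain ⟨f, hf⟩ := exists_hom_of_isometry_single (A := A) (B := directSum N)
    U.symm.toLinearIsometry hS fun s hs => by
      refine ⟨⟨U.toContinuousLinearEquiv.toContinuousLinearMap ∘L s ∘L
        U.symm.toContinuousLinearEquiv.toContinuousLinearMap, fun i => ?_⟩, fun v => ?_⟩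
      · obtain ⟨b, hb⟩ := h s hs i
        refine ⟨b, b.2, fun v => ?_⟩
        change U (s (U.symm v)) i = _
        rw [hb, U.apply_symm_apply]
      · exact U.symm_apply_apply _
  obtain ⟨g, hg⟩ := exists_hom_of_isometry_single (A := directSum N) (B := A)
    U.toLinearIsometry (isGenerating_directSumAlg hS' h1) (by
      rintro _ ⟨i, s, hs, rfl⟩
      exact h' i s hs)
  have hf' : ∀ x v, (Hom.toFun f x : (directSum N).space →L[ℂ] (directSum N).space) (U v) =
      U ((x : A.space →L[ℂ] A.space) v) := fun x v => by
    have := hf x (U v)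
    change U.symm _ = (x : A.space →L[ℂ] A.space) (U.symm (U v)) at this
    rw [U.symm_apply_apply] at this
    rw [← this]
    exact (U.apply_symm_apply _).symm
  have hg' : ∀ x v, U ((Hom.toFun g x : A.space →L[ℂ] A.space) v) =
      (x : (directSum N).space →L[ℂ] (directSum N).space) (U v) := hg
  refine ⟨⟨f, g, ?_, ?_⟩, fun x v i => ?_⟩
  · refine Hom.ext (StarAlgHom.ext fun x => Subtype.ext (ContinuousLinearMap.ext fun v =>
      U.injective ?_))
    exact (hg' _ v).trans (hf' x v)
  · refine Hom.ext (StarAlgHom.ext fun x => Subtype.ext (ContinuousLinearMap.ext fun v => ?_))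
    obtain ⟨w, rfl⟩ := U.surjective v
    exact (hf' _ w).trans (hg' x w)
  · rw [← hf']
    exact (IsDiagonal.apply_eq (Hom.toFun f x).2 i (U v)).symm

end WStar

end FreeExp

end
-- Distributivity of the tensor product and the associated functors.
noncomputable section

namespace FreeExp

theorem unitary_tensorOp_apply {H : Type*} [NormedAddCommGroup H] [InnerProductSpace ℂ H]
    {I : Type*} {K : I → Type*} [∀ i, NormedAddCommGroup (K i)] [∀ i, InnerProductSpace ℂ (K i)]
    {L : I → Type*} [∀ i, NormedAddCommGroup (L i)] [∀ i, InnerProductSpace ℂ (L i)]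
    {β : ∀ i, H → K i → L i} {U : HilbertTensor H (lp K 2) ≃ₗᵢ[ℂ] lp L 2}
    (hU : ∀ x y i, U (htmul x y) i = β i x (y i)) {a : H →L[ℂ] H} {b : lp K 2 →L[ℂ] lp K 2} {i : I}
    {D : L i →L[ℂ] L i} (h : ∀ x (y : lp K 2), β i (a x) (b y i) = D (β i x (y i)))
    (v : HilbertTensor H (lp K 2)) : U (tensorOp a b v) i = D (U v i) := by
  suffices coordL L i ∘L U.toContinuousLinearEquiv.toContinuousLinearMap ∘L tensorOp a b =
      D ∘L coordL L i ∘L U.toContinuousLinearEquiv.toContinuousLinearMap from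
    congrArg (fun f => f v) this
  refine ext_htmul fun x y => ?_
  change U (tensorOp a b (htmul x y)) i = D (U (htmul x y) i)
  rw [tensorOp_htmul, hU, hU, h]

theorem surjective_coord_unitary {H : Type*} [NormedAddCommGroup H] [InnerProductSpace ℂ H]
    {I : Type*} {L : I → Type*} [∀ i, NormedAddCommGroup (L i)] [∀ i, InnerProductSpace ℂ (L i)]
    (U : H ≃ₗᵢ[ℂ] lp L 2) (i : I) : Function.Surjective fun v => U v i := fun z =>
  ⟨U.symm (inclL L i z), by
    change U (U.symm _) i = z
    rw [U.apply_symm_apply, inclL_self]⟩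

namespace WStar

/-- The spatial tensor product distributes over direct sums. -/
theorem exists_iso_tensor_directSum {I : Type u} (R : WStar.{u}) (N : I → WStar.{u}) :
    ∃ e : tensor R (directSum N) ≅ directSum fun i => tensor R (N i),
      ∀ i, e.hom ≫ proj _ i = tensorHom (𝟙 R) (proj N i) := by
  obtain ⟨U, hU⟩ := exists_unitary_tensor_lp (H := R.space) (K := fun i => (N i).space)
    (L := fun i => HilbertTensor R.space (N i).space) (fun _ => htmul)
    (fun _ x x' y y' => inner_htmul x x' y y') fun i => dense_span_htmul R.space (N i).space
  have key : ∀ (m : R.Carrier) (n : (directSum N).Carrier) i v,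
      U (tensorOp (m : R.space →L[ℂ] R.space)
        n.1 v) i =
      tensorOp (m : R.space →L[ℂ] R.space)
        (Hom.toFun (proj N i) n : (N i).space →L[ℂ] (N i).space) (U v i) := by
    intro m n i v
    refine unitary_tensorOp_apply hU (fun x y => ?_) v
    rw [tensorOp_htmul]
    exact congrArg (htmul _) (IsDiagonal.apply_eq n.2 i y)
  obtain ⟨e, he⟩ := exists_iso_directSum (A := tensor R (directSum N))
    (N := fun i => tensor R (N i)) U (isGenerating_tensor R (directSum N))
    (fun i => isGenerating_tensor R (N i))
    (fun i => ⟨1, 1, ext_htmul fun x y =>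
      (tensorOp_htmul (1 : R.space →L[ℂ] R.space) (1 : (N i).space →L[ℂ] (N i).space) x y).symm⟩)
    (by
      rintro _ ⟨m, n, rfl⟩ i
      exact ⟨tmul m (Hom.toFun (proj N i) n), key m n i⟩)
    (by
      rintro i _ ⟨m, n, rfl⟩
      -- The element with `n` in the summand `i` and zero elsewhere: `m ⊗ n'` realizes the generator
      -- `m ⊗ n` of the `i`-th block.
      let n' : (directSum N).Carrier :=
        ⟨_, isDiagonal_inclL_comp_coordL (N := fun i => (N i).alg) i n.2⟩
      refine ⟨tmul m n', fun v => lp.ext (funext fun j => ?_)⟩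
      refine (key m n' j v).trans ?_
      by_cases h : j = i
      · subst h
        have : Hom.toFun (proj N j) n' = n := Subtype.ext (ContinuousLinearMap.ext fun y => by
          change inclL (fun i => (N i).space) j ((n : (N j).space →L[ℂ] (N j).space)
            (inclL (fun i => (N i).space) j y j)) j = _
          rw [inclL_self, inclL_self])
        rw [this, inclL_self]
        rfl
      · have : Hom.toFun (proj N j) n' = 0 := Subtype.ext (ContinuousLinearMap.ext fun y => by
          change inclL (fun i => (N i).space) i _ j = 0
          rw [inclL_ne h])
        rw [this, inclL_ne h]
        have h0 : tensorOp (m : R.space →L[ℂ] R.space) (0 : (N j).space →L[ℂ] (N j).space) = 0 :=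
          ext_htmul fun x y => by
            rw [tensorOp_htmul]
            change htmul _ 0 = 0
            rw [← norm_eq_zero, norm_htmul, norm_zero, mul_zero]
        exact congrArg (fun f => f (U v j)) h0)
  refine ⟨e, fun i => tensor_hom_ext fun m n => ?_⟩
  rw [tensorHom_tmul]
  refine Subtype.ext (ContinuousLinearMap.ext fun v => ?_)
  obtain ⟨w, rfl⟩ := surjective_coord_unitary U i v
  exact (he (tmul m n) w i).trans (key m n i w)

/-- `F ⊗ ℓ^∞(X)` is the direct sum of copies of `F` indexed by `X`. -/
theorem exists_iso_tensor_linfty (F : WStar.{u}) (X : Type u) :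
    ∃ e : tensor F (linfty X) ≅ directSum fun _ : X => F,
      ∀ x, IsEvalHom x (e.hom ≫ proj _ x) := by
  obtain ⟨U, hU⟩ := exists_unitary_tensor_lp (H := F.space) (K := fun _ : X => ℂ)
    (L := fun _ : X => F.space) (fun _ h c => c • h)
    (fun _ x x' y y' => by
      rw [inner_smul_left, inner_smul_right, RCLike.inner_apply]
      ring) fun i => by
        rw [eq_top_iff]
        refine le_trans (fun h _ => ?_) (Submodule.le_topologicalClosure _)
        exact Submodule.subset_span ⟨(h, 1), one_smul ℂ h⟩
  have hlin : ∀ (f : (linfty X).Carrier) (y : lp (fun _ : X => ℂ) 2) x,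
      coordL (fun _ : X => ℂ) x (f.1 y) = linftyApply f x * y x := by
    intro f y x
    refine (IsDiagonal.apply_eq f.2 x y).trans ?_
    rw [linftyApply, mul_comm, ← smul_eq_mul, ← map_smul, smul_eq_mul,
      mul_one]
  have key : ∀ (m : F.Carrier) (f : (linfty X).Carrier) x v,
      U (tensorOp (m : F.space →L[ℂ] F.space)
        f.1 v) x =
      linftyApply f x • (m : F.space →L[ℂ] F.space) (U v x) := by
    intro m f x v
    refine unitary_tensorOp_apply (K := fun _ : X => ℂ) (L := fun _ : X => F.space)
      (β := fun _ h c => c • h) (D := linftyApply f x • (m : F.space →L[ℂ] F.space)) hU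
      (fun h y => ?_) v
    change coordL (fun _ : X => ℂ) x (f.1 y) • _ =
      linftyApply f x • (m : F.space →L[ℂ] F.space) (y x • h)
    rw [hlin, map_smul, smul_smul]
  obtain ⟨e, he⟩ := exists_iso_directSum (A := tensor F (linfty X))
    (N := fun _ : X => F) U (isGenerating_tensor F (linfty X))
    (fun _ => IsGenerating.self F.alg) (fun _ => one_mem F.alg.toStarSubalgebra)
    (by
      rintro _ ⟨m, f, rfl⟩ x
      exact ⟨linftyApply f x • m, key m f x⟩)
    (by
      intro x s hs
      -- The indicator function of `{x}`.
      let f : (linfty X).Carrier := ⟨inclL (fun _ : X => ℂ) x ∘L 1 ∘L coordL (fun _ : X => ℂ) x,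
        isDiagonal_inclL_comp_coordL (N := fun _ => complexAlg) x
          (one_mem complexAlg.toStarSubalgebra)⟩
      refine ⟨tmul ⟨s, hs⟩ f, fun v => lp.ext (funext fun y => ?_)⟩
      refine (key ⟨s, hs⟩ f y v).trans ?_
      by_cases h : y = x
      · subst h
        have : linftyApply f y = 1 := by
          change inclL (fun _ : X => ℂ) y (inclL (fun _ : X => ℂ) y 1 y) y = 1
          rw [inclL_self, inclL_self]
        rw [this, one_smul, inclL_self]
        rfl
      · have : linftyApply f y = 0 := by
          change inclL (fun _ : X => ℂ) x _ y = 0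
          rw [inclL_ne h]
        rw [this, zero_smul, inclL_ne h])
  refine ⟨e, fun x m f => Subtype.ext (ContinuousLinearMap.ext fun v => ?_)⟩
  obtain ⟨w, rfl⟩ := surjective_coord_unitary U x v
  exact (he (tmul m f) w x).trans (key m f x w)

/-- Tensoring on the right with a fixed `W*`-algebra, as a functor. -/
def tensorRight (N : WStar.{u}) : WStar.{u} ⥤ WStar.{u} where
  obj R := tensor R N
  map f := tensorHom f (𝟙 N)
  map_id R := tensorHom_id R N
  map_comp f g := tensorHom_comp f (𝟙 N) g (𝟙 N)

/-- Tensoring with a fixed morphism on the right, as a natural transformation. -/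
def tensorRightMap {N N' : WStar.{u}} (g : N ⟶ N') : tensorRight N ⟶ tensorRight N' where
  app R := tensorHom (𝟙 R) g
  naturality R R' f := by
    change tensorHom f (𝟙 N) ≫ tensorHom (𝟙 R') g = tensorHom (𝟙 R) g ≫ tensorHom f (𝟙 N')
    rw [← tensorHom_comp, ← tensorHom_comp, Category.id_comp, Category.comp_id, Category.id_comp,
      Category.comp_id]

theorem tensorRightMap_comp {N N' N'' : WStar.{u}} (g : N ⟶ N') (g' : N' ⟶ N'') :
    tensorRightMap (g ≫ g') = tensorRightMap g ≫ tensorRightMap g' := by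
  ext R
  change tensorHom (𝟙 R) (g ≫ g') = tensorHom (𝟙 R) g ≫ tensorHom (𝟙 R) g'
  rw [← tensorHom_comp, Category.id_comp]

/-- Transports the product property of a direct sum along `e`; with the two distributivity
isomorphisms this yields the pointwise products of functors. -/
theorem existsUnique_lift_of_iso {I : Type u} {B : I → WStar.{u}} {A : WStar.{u}}
    (e : A ≅ directSum B) {M : WStar.{u}} (π : ∀ i, M ⟶ B i) :
    ∃! f : M ⟶ A, ∀ i, f ≫ e.hom ≫ proj B i = π i := by
  obtain ⟨f, hf⟩ := exists_directSum_lift π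
  refine ⟨f ≫ e.inv, fun i => by simp [hf], fun g hg => ?_⟩
  rw [Iso.eq_comp_inv]
  refine directSum_hom_ext fun i => ?_
  rw [Category.assoc, hg, hf]

theorem existsUnique_lift_tensor_directSum {I : Type u} (N : I → WStar.{u}) {M R : WStar.{u}}
    (π : ∀ i, M ⟶ (tensorRight (N i)).obj R) :
    ∃! f : M ⟶ (tensorRight (directSum N)).obj R,
      ∀ i, f ≫ (tensorRightMap (proj N i)).app R = π i := by
  obtain ⟨e, he⟩ := exists_iso_tensor_directSum R N
  have h := existsUnique_lift_of_iso e π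
  simp_rw [he] at h
  exact h

theorem exists_isEvalHom {X : Type u} (F : WStar.{u}) (x : X) :
    ∃ τ : tensor F (linfty X) ⟶ F, IsEvalHom x τ :=
  ⟨_, (exists_iso_tensor_linfty F X).choose_spec x⟩

/-- Evaluation at `x`, as a natural transformation. -/
def evalNat {X : Type u} (x : X) : tensorRight (linfty X) ⟶ 𝟭 WStar.{u} where
  app F := (exists_isEvalHom F x).choose
  naturality F F' f := tensor_hom_ext fun m a => by
    change Hom.toFun (exists_isEvalHom F' x).choose (Hom.toFun (tensorHom f (𝟙 _)) (tmul m a)) =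
      Hom.toFun f (Hom.toFun (exists_isEvalHom F x).choose (tmul m a))
    rw [(exists_isEvalHom F x).choose_spec, tensorHom_tmul, map_smul]
    exact (exists_isEvalHom F' x).choose_spec _ _

theorem isEvalHom_iff {X : Type u} {F : WStar.{u}} {x : X} {τ : tensor F (linfty X) ⟶ F} :
    IsEvalHom x τ ↔ τ = (evalNat x).app F := by
  refine ⟨fun h => tensor_hom_ext fun m a => ?_, ?_⟩
  · rw [h m a]
    exact ((exists_isEvalHom F x).choose_spec m a).symm
  · rintro rfl
    exact (exists_isEvalHom F x).choose_spec

theorem existsUnique_lift_tensor_linfty {X : Type u} {M R : WStar.{u}} (π : X → (M ⟶ R)) :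
    ∃! f : M ⟶ (tensorRight (linfty X)).obj R, ∀ x, f ≫ (evalNat x).app R = π x := by
  obtain ⟨e, he⟩ := exists_iso_tensor_linfty R X
  have h := existsUnique_lift_of_iso e π
  simp_rw [fun x => isEvalHom_iff.1 (he x)] at h
  exact h

end WStar

end FreeExp

end
-- Universal arrows to pointwise products of functors.
noncomputable section

namespace FreeExp

section Universal

variable {C : Type*} [Category C]

/-- `ε` is a universal arrow from `M` to the functor `F`. -/
def IsUniversalArrow (F : C ⥤ C) {M E : C} (ε : M ⟶ F.obj E) : Prop :=
  ∀ ⦃R : C⦄ (π : M ⟶ F.obj R), ∃! ρ : E ⟶ R, ε ≫ F.map ρ = π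

theorem IsUniversalArrow.hom_ext {F : C ⥤ C} {M E R : C} {ε : M ⟶ F.obj E}
    (hε : IsUniversalArrow F ε) {f g : E ⟶ R} (h : ε ≫ F.map f = ε ≫ F.map g) : f = g :=
  (hε _).unique h rfl

/-- This makes the case of `ℓ^∞(X)` an instance of the general statement, with every factor the
identity functor. -/
theorem isUniversalArrow_id (M : C) : IsUniversalArrow (𝟭 C) (𝟙 M) := fun _ π =>
  ⟨π, Category.id_comp π, fun ρ h => (Category.id_comp ρ).symm.trans h⟩

/-- Universal arrows to the same functor are isomorphic by a unique isomorphism. -/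
theorem IsUniversalArrow.existsUnique_iso {F : C ⥤ C} {M E E' : C} {ε : M ⟶ F.obj E}
    {ε' : M ⟶ F.obj E'} (hε : IsUniversalArrow F ε) (hε' : IsUniversalArrow F ε') :
    ∃! θ : E' ≅ E, ε ≫ F.map θ.inv = ε' := by
  obtain ⟨f, hf, -⟩ := hε ε'
  obtain ⟨g, hg, -⟩ := hε' ε
  refine ⟨⟨g, f, hε'.hom_ext ?_, hε.hom_ext ?_⟩, hf, fun θ hθ => ?_⟩
  · rw [F.map_comp, reassoc_of% hg, hf, F.map_id, Category.comp_id]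
  · rw [F.map_comp, reassoc_of% hf, hg, F.map_id, Category.comp_id]
  · exact (Iso.ext_inv (hε.hom_ext (hf.trans hθ.symm))).symm

variable {I : Type*} {T : C ⥤ C} {T' : I → C ⥤ C} (q : ∀ i, T ⟶ T' i)

/-- The functor `T` is the pointwise product of the functors `T' i`. -/
def IsPointwiseProduct : Prop :=
  ∀ (M R : C) (π : ∀ i, M ⟶ (T' i).obj R), ∃! f : M ⟶ T.obj R, ∀ i, f ≫ (q i).app R = π i

variable {q} (hq : IsPointwiseProduct q) {M : C} {E : I → C} {ε : ∀ i, M ⟶ (T' i).obj (E i)}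
  (hε : ∀ i, IsUniversalArrow (T' i) (ε i)) {P : Cofan E} (hP : IsColimit P)

include hq hε hP in
/-- The coproduct of universal arrows to the factors is a universal arrow to the product. -/
theorem IsPointwiseProduct.isUniversalArrow {δ : M ⟶ T.obj P.pt}
    (hδ : ∀ i, ε i ≫ (T' i).map (P.inj i) = δ ≫ (q i).app P.pt) : IsUniversalArrow T δ := by
  intro R π
  choose ρ hρ hρu using fun i => hε i (π ≫ (q i).app R)
  -- Solving `δ ≫ T.map k = π` can be tested in each factor, where universality of `ε i` prescribes
  -- the restriction of `k` to the `i`-th summand.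
  have key : ∀ k : P.pt ⟶ R, δ ≫ T.map k = π ↔ ∀ i, P.inj i ≫ k = ρ i := by
    intro k
    have h : ∀ i, (δ ≫ T.map k) ≫ (q i).app R = ε i ≫ (T' i).map (P.inj i ≫ k) := fun i => by
      rw [Category.assoc, (q i).naturality, ← Category.assoc, ← hδ, Category.assoc,
        (T' i).map_comp]
    constructor
    · intro hk i
      exact hρu i _ ((h i).symm.trans (by rw [hk]))
    · intro hk
      refine (hq M R fun i => π ≫ (q i).app R).unique (fun i => ?_) fun i => rfl
      rw [h, hk]
      exact hρ i
  refine ⟨Cofan.IsColimit.desc hP ρ, (key _).2 fun i => Cofan.IsColimit.fac hP ρ i, fun k hk => ?_⟩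
  refine Cofan.IsColimit.hom_ext hP _ _ fun i => ?_
  rw [(key k).1 hk i]
  exact (Cofan.IsColimit.fac hP ρ i).symm

include hq in
theorem IsPointwiseProduct.existsUnique_lift {R : C} (k : ∀ i, E i ⟶ R) :
    ∃! δ : M ⟶ T.obj R, ∀ i, ε i ≫ (T' i).map (k i) = δ ≫ (q i).app R := by
  simpa only [eq_comm] using hq M R fun i => ε i ≫ (T' i).map (k i)

include hq hε hP in
-- Componentwise compatibility of `θ` says exactly that `T.map θ.inv` carries the universal arrow
-- `δ` to `η`, so uniqueness of universal arrows applies.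
theorem IsPointwiseProduct.existsUnique_iso {F : C} {η : M ⟶ T.obj F}
    (hη : IsUniversalArrow T η) :
    ∃! θ : F ≅ P.pt, ∀ i, ε i ≫ (T' i).map (P.inj i ≫ θ.inv) = η ≫ (q i).app F := by
  obtain ⟨δ, hδ, -⟩ := hq M P.pt fun i => ε i ≫ (T' i).map (P.inj i)
  have huniv := hq.isUniversalArrow hε hP fun i => (hδ i).symm
  have key : ∀ θ : F ≅ P.pt, (δ ≫ T.map θ.inv = η) ↔
      ∀ i, ε i ≫ (T' i).map (P.inj i ≫ θ.inv) = η ≫ (q i).app F := by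
    intro θ
    have h : ∀ i, (δ ≫ T.map θ.inv) ≫ (q i).app F = ε i ≫ (T' i).map (P.inj i ≫ θ.inv) :=
      fun i => by
        rw [Category.assoc, (q i).naturality, ← Category.assoc, hδ, Category.assoc,
          (T' i).map_comp]
    constructor
    · intro hθ i
      rw [← h, hθ]
    · intro hθ
      refine (hq M F fun i => η ≫ (q i).app F).unique (fun i => ?_) fun i => rfl
      rw [h, hθ]
  simp_rw [← key]
  exact huniv.existsUnique_iso hη

include hε hP in
/-- Naturality of the isomorphism between a universal arrow to a product and the coproduct of
universal arrows to the factors. -/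
theorem comp_desc_eq_of_natTrans {S : C ⥤ C} {S' : I → C ⥤ C} {r : ∀ i, S ⟶ S' i}
    {Γ : S ⟶ T} {γ : ∀ i, S' i ⟶ T' i} (hΓ : ∀ i, Γ ≫ q i = r i ≫ γ i)
    {M' : C} {E' : I → C} {ε' : ∀ i, M' ⟶ (S' i).obj (E' i)} {P' : Cofan E'} {F F' : C}
    {η : M ⟶ T.obj F} {η' : M' ⟶ S.obj F'}
    {θ : F ≅ P.pt} (hθ : ∀ i, ε i ≫ (T' i).map (P.inj i ≫ θ.inv) = η ≫ (q i).app F)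
    {θ' : F' ≅ P'.pt} (hθ' : ∀ i, ε' i ≫ (S' i).map (P'.inj i ≫ θ'.inv) = η' ≫ (r i).app F')
    {f : M ⟶ M'} {h : F ⟶ F'} (hh : η ≫ T.map h = f ≫ η' ≫ Γ.app F')
    {k : ∀ i, E i ⟶ E' i} (hk : ∀ i, ε i ≫ (T' i).map (k i) = f ≫ ε' i ≫ (γ i).app (E' i)) :
    θ.hom ≫ Cofan.IsColimit.desc hP (fun i => k i ≫ P'.inj i) = h ≫ θ'.hom := by
  -- Both sides become morphisms out of the coproduct. Restricting to the `i`-th summand and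
  -- precomposing with the universal arrow `ε i` leaves an identity between morphisms out of `M`.
  rw [← Iso.eq_inv_comp]
  refine Cofan.IsColimit.hom_ext hP _ _ fun i => ?_
  refine (Cofan.IsColimit.fac hP _ i).trans ((hε i).hom_ext ?_)
  have hΓi : Γ.app F' ≫ (q i).app F' = (r i).app F' ≫ (γ i).app F' := NatTrans.congr_app (hΓ i) F'
  have h' : ε' i ≫ (S' i).map (P'.inj i) = η' ≫ (r i).app F' ≫ (S' i).map θ'.hom := by
    rw [← Category.assoc, ← hθ', Category.assoc, ← Functor.map_comp, Category.assoc,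
      Iso.inv_hom_id, Category.comp_id]
  have h1 : ε i ≫ (T' i).map (k i ≫ P'.inj i) =
      f ≫ (ε' i ≫ (S' i).map (P'.inj i)) ≫ (γ i).app P'.pt := by
    rw [Functor.map_comp, ← Category.assoc, hk]
    simp only [Category.assoc]
    rw [(γ i).naturality]
  have h2 : ε i ≫ (T' i).map (P.inj i ≫ θ.inv ≫ h ≫ θ'.hom) =
      (η ≫ T.map h) ≫ (q i).app F' ≫ (T' i).map θ'.hom := by
    rw [← Category.assoc (P.inj i), Functor.map_comp, ← Category.assoc, hθ, Category.assoc,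
      Category.assoc, Functor.map_comp, ← (q i).naturality_assoc]
  rw [h1, h2, hh, h']
  simp only [Category.assoc]
  rw [(γ i).naturality, reassoc_of% hΓi]

end Universal

/-! ### Free exponentials and compatibility in terms of functors. -/

namespace WStar

variable {M M' N N' E E' F R : WStar.{u}}

/-- The witness `τ` is forced to be `tensorHom ρ (𝟙 N)`, so the inner existential collapses to an
equation. -/
theorem isFreeExponential_iff {ε : M ⟶ tensor E N} :
    IsFreeExponential ε ↔ IsUniversalArrow (tensorRight N) ε := by
  simp only [IsFreeExponential, isTensorHom_iff, exists_eq_left]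
  rfl

theorem isCompatible_iff {I : Type u} {N E : I → WStar.{u}} {ε : ∀ i, M ⟶ tensor (E i) (N i)}
    {η : M ⟶ tensor F (directSum N)} {k : ∀ i, E i ⟶ F} :
    IsCompatible ε η k ↔
      ∀ i, ε i ≫ (tensorRight (N i)).map (k i) = η ≫ (tensorRightMap (proj N i)).app F := by
  simp only [IsCompatible, isTensorHom_iff, exists_and_left, exists_eq_left]
  rfl

theorem isCompatibleEval_iff {X : Type u} {η : M ⟶ tensor F (linfty X)} {k : X → (M ⟶ F)} :
    IsCompatibleEval η k ↔ ∀ x, 𝟙 M ≫ (𝟭 WStar.{u}).map (k x) = η ≫ (evalNat x).app F := by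
  simp only [IsCompatibleEval, isEvalHom_iff, Category.id_comp]
  exact forall_congr' fun x => ⟨fun ⟨_, h, h'⟩ => h'.symm.trans (by rw [h]), fun h => ⟨_, rfl, h.symm⟩⟩

theorem isInducedHom_iff {ε : M ⟶ tensor E N} {ε' : M' ⟶ tensor E' N'} {f : M ⟶ M'} {g : N' ⟶ N}
    {h : E ⟶ E'} :
    IsInducedHom ε ε' f g h ↔
      ε ≫ (tensorRight N).map h = f ≫ ε' ≫ (tensorRightMap g).app E' := by
  simp only [IsInducedHom, isTensorHom_iff, exists_and_left, exists_eq_left]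
  rfl

theorem isPointwiseProduct_directSum {I : Type u} (N : I → WStar.{u}) :
    IsPointwiseProduct fun i => tensorRightMap (proj N i) := fun _ _ =>
  existsUnique_lift_tensor_directSum N

theorem isPointwiseProduct_linfty (X : Type u) :
    IsPointwiseProduct fun x : X => (evalNat x : tensorRight (linfty X) ⟶ 𝟭 WStar.{u}) :=
  fun _ _ => existsUnique_lift_tensor_linfty

theorem existsUnique_directSum_map {I : Type u} {N N' : I → WStar.{u}} (g : ∀ i, N' i ⟶ N i) :
    ∃! G : directSum N' ⟶ directSum N, ∀ i, G ≫ proj N i = proj N' i ≫ g i := by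
  simpa using existsUnique_lift_of_iso (Iso.refl (directSum N)) fun i => proj N' i ≫ g i

theorem existsUnique_isInducedHom {ε : M ⟶ tensor E N} (hε : IsFreeExponential ε)
    (ε' : M' ⟶ tensor E' N') (f : M ⟶ M') (g : N' ⟶ N) :
    ∃! h : E ⟶ E', IsInducedHom ε ε' f g h := by
  simp_rw [isInducedHom_iff]
  exact isFreeExponential_iff.1 hε _

end WStar

end FreeExp

end

theorem mainTheorem7 :
    -- the free product of the free exponentials `E i` of `M` and `N i` is, canonically, the free
    -- exponential of `M` and the direct sum of the `N i`
    (∀ (M : WStar.{u}) (I : Type u) (N E : I → WStar.{u})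
        (ε : ∀ i, M ⟶ tensor (E i) (N i)) (_ : ∀ i, IsFreeExponential (ε i))
        (P : Cofan E) (_ : IsColimit P),
      (∃! δ : M ⟶ tensor P.pt (directSum N), IsCompatible ε δ P.inj) ∧
      (∀ δ : M ⟶ tensor P.pt (directSum N), IsCompatible ε δ P.inj → IsFreeExponential δ) ∧
      (∀ (F : WStar.{u}) (η : M ⟶ tensor F (directSum N)), IsFreeExponential η →
        ∃! θ : F ≅ P.pt, IsCompatible ε η fun i => P.inj i ≫ θ.inv)) ∧
    -- these isomorphisms are natural in `M` and in the family `N`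
    (∀ (M M' : WStar.{u}) (I : Type u) (N N' E E' : I → WStar.{u})
        (ε : ∀ i, M ⟶ tensor (E i) (N i)) (_ : ∀ i, IsFreeExponential (ε i))
        (ε' : ∀ i, M' ⟶ tensor (E' i) (N' i)) (_ : ∀ i, IsFreeExponential (ε' i))
        (P : Cofan E) (hP : IsColimit P) (P' : Cofan E') (_ : IsColimit P')
        (F F' : WStar.{u})
        (η : M ⟶ tensor F (directSum N)) (_ : IsFreeExponential η)
        (η' : M' ⟶ tensor F' (directSum N')) (_ : IsFreeExponential η')
        (θ : F ≅ P.pt) (_ : IsCompatible ε η fun i => P.inj i ≫ θ.inv)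
        (θ' : F' ≅ P'.pt) (_ : IsCompatible ε' η' fun i => P'.inj i ≫ θ'.inv)
        (f : M ⟶ M') (g : ∀ i, N' i ⟶ N i),
      (∃! G : directSum N' ⟶ directSum N, ∀ i, G ≫ proj N i = proj N' i ≫ g i) ∧
      (∀ i, ∃! k : E i ⟶ E' i, IsInducedHom (ε i) (ε' i) f (g i) k) ∧
      (∀ G : directSum N' ⟶ directSum N, (∀ i, G ≫ proj N i = proj N' i ≫ g i) →
        (∃! h : F ⟶ F', IsInducedHom η η' f G h) ∧
        ∀ (h : F ⟶ F') (k : ∀ i, E i ⟶ E' i), IsInducedHom η η' f G h →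
          (∀ i, IsInducedHom (ε i) (ε' i) f (g i) (k i)) →
          θ.hom ≫ Cofan.IsColimit.desc hP (fun i => k i ≫ P'.inj i) = h ≫ θ'.hom)) ∧
    -- the free product of copies of `M` indexed by `X` is, canonically, the free exponential of `M`
    -- and `ℓ^∞(X)`
    (∀ (M : WStar.{u}) (X : Type u) (P : Cofan fun _ : X => M) (_ : IsColimit P),
      (∃! δ : M ⟶ tensor P.pt (linfty X), IsCompatibleEval δ P.inj) ∧
      (∀ δ : M ⟶ tensor P.pt (linfty X), IsCompatibleEval δ P.inj → IsFreeExponential δ) ∧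
      (∀ (F : WStar.{u}) (η : M ⟶ tensor F (linfty X)), IsFreeExponential η →
        ∃! θ : F ≅ P.pt, IsCompatibleEval η fun x => P.inj x ≫ θ.inv)) := by
  refine ⟨fun M I N E ε hε P hP => ?_, fun M M' I N N' E E' ε hε ε' hε' P hP P' _ F F' η hη η' _
    θ hθ θ' hθ' f g => ⟨existsUnique_directSum_map g,
      fun i => existsUnique_isInducedHom (hε i) (ε' i) f (g i), fun G hG =>
      ⟨existsUnique_isInducedHom hη η' f G, fun h k hh hk =>
        comp_desc_eq_of_natTrans (fun i => isFreeExponential_iff.1 (hε i)) hP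
          (q := fun i => tensorRightMap (proj N i)) (r := fun i => tensorRightMap (proj N' i))
          (fun i => by rw [← tensorRightMap_comp, hG, tensorRightMap_comp])
          (isCompatible_iff.1 hθ) (isCompatible_iff.1 hθ') (isInducedHom_iff.1 hh)
          fun i => isInducedHom_iff.1 (hk i)⟩⟩, fun M X P hP => ?_⟩
  · simp only [isFreeExponential_iff, isCompatible_iff] at hε ⊢
    have hq := isPointwiseProduct_directSum N
    refine ⟨hq.existsUnique_lift _, fun δ hδ => hq.isUniversalArrow hε hP hδ,
      fun F η hη => hq.existsUnique_iso hε hP hη⟩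
  · simp only [isFreeExponential_iff, isCompatibleEval_iff]
    have hq := isPointwiseProduct_linfty X
    have hε : ∀ _ : X, IsUniversalArrow (𝟭 WStar.{u}) (𝟙 M) := fun _ => isUniversalArrow_id M
    refine ⟨hq.existsUnique_lift _, fun δ hδ => hq.isUniversalArrow hε hP hδ,
      fun F η hη => hq.existsUnique_iso hε hP hη⟩
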